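/- Theorem 1.1. Let $m\ge 1$. For a matrix function $a:\mathbb T\to\mathbb C^{m\times m}$ on the unit circle let $a_n$ ($n\in\mathbb Z$) be its Fourier coefficients, and let $W\cap K^{1/2,1/2}_{2,2}$ (Wiener algebra intersected with Krein algebra) be the set of all continuous $a$ with $\sum_{n\in\mathbb Z}\|a_n\|+\sum_{n\in\mathbb Z}|n|\,\|a_n\|^2<\infty$. Suppose that $a\in W\cap K^{1/2,1/2}_{2,2}$ has canonical right and left Wiener–Hopf factorizations $a=w_-w_+=v_+v_-$ in $W\cap K^{1/2,1/2}_{2,2}$, i.e. $w_+,v_+,\overline{w_-},\overline{v_-}$ are invertible on $\mathbb T$ and, together with their inverses, belong to $W\cap K^{1/2,1/2}_{2,2}\cap H^\infty$. Put $b=v_-w_+^{-1}$ and $c=w_-^{-1}v_+$. Let $P$ be the orthogonal projection of $L^2=L^2(\mathbb T;\mathbb C^m)$ onto the Hardy space $H^2$ of functions whose Fourier coefficients with negative index vanish. On $H^2$ let $T(\varphi)f=P(\varphi f)$ and $H(\varphi)f=P(\varphi\cdot(I-P)Jf)$, where $(Jf)(t)=t^{-1}f(t^{-1})$, be the Toeplitz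 and Hankel operators with symbol $\varphi$, and put $\tilde\varphi(t)=\varphi(1/t)$. For $\alpha\in\mathbb D$ let $$\mu_\alpha(z)=\frac{z-\alpha}{1-\overline\alpha z},\qquad B_\alpha(z)=\frac{-\overline\alpha}{|\alpha|}\,\mu_\alpha(z)\ (\alpha\neq 0),\qquad B_0(z)=z .$$ Let $u=B_{\alpha_1}\cdots B_{\alpha_N}$ with $\alpha_1,\dots,\alpha_N\in\mathbb D$ be a finite Blaschke product and let $\sigma(u)$ be the family $\alpha_1,\dots,\alpha_N$, with repetitions. Let $P_u$ be the orthogonal projection of $H^2$ onto the model space $K_u=H^2\ominus uH^2$, let $Q_u=I-P_u$, and let $T_u(a)=P_uT(a)|K_u$. Finally, for a matrix function $\varphi$ on $\mathbb T$ let $G(\varphi)=\exp\bigl(\frac1{2\pi}\int_0^{2\pi}\log\det\varphi(e^{i\theta})\,d\theta\bigr)$, where $\log\det\varphi$ is a continuous logarithm of $\det\varphi$ on $\mathbb T$. Then $K_u$ is finite-dimensional, $\det(a\circ\mu_{-\alpha})$ has a continuous logarithm on $\mathbb T$ for every $\alpha\in\sigma(u)$, the operators $H(b)H(\tilde c)$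 and $Q_uH(b)H(\tilde c)Q_u$ are of trace class, the Fredholm determinant $\det(I-H(b)H(\tilde c))$ is nonzero, and $$\det T_u(a)=\Bigl(\prod_{\alpha\in\sigma(u)}G(a\circ\mu_{-\alpha})\Bigr)\,\frac{\det\bigl(I-Q_uH(b)H(\tilde c)Q_u\bigr)}{\det\bigl(I-H(b)H(\tilde c)\bigr)} .$$ -/

import Mathlib

open MeasureTheory Filter Topology
open scoped ENNReal ComplexConjugate Complex.UnitDisc

noncomputable section

namespace ModelBO

/-! ### The space `L²(𝕋; ℂᵐ)` and the Hardy space `H²`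

The unit circle is parametrised by `x ↦ e^{2πix}`, `x ∈ ℝ/ℤ`, with normalised Haar measure.
Symbols are functions on `Circle`. -/

/-- The space `ℂᵐ` with its Hermitian inner product. -/
abbrev Vec (m : ℕ) : Type := EuclideanSpace ℂ (Fin m)

/-- Complex `m × m` matrices. -/
abbrev Mat (m : ℕ) : Type := Matrix (Fin m) (Fin m) ℂ

/-- The point `e^{2πix}` of the unit circle. -/
def pt (x : UnitAddCircle) : Circle := AddCircle.toCircle x

/-- `L²(𝕋; ℂᵐ)`. -/
abbrev L2 (m : ℕ) : Type := Lp (Vec m) 2 (AddCircle.haarAddCircle (T := (1 : ℝ)))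

/-- The `n`th Fourier coefficient as a bounded linear map on `L²(𝕋; ℂᵐ)`. -/
def coeffCLM (m : ℕ) (n : ℤ) : L2 m →L[ℂ] Vec m :=
  (ContinuousLinearMap.lsmul ℂ ℂ : ℂ →L[ℂ] Vec m →L[ℂ] Vec m).lpPairing
    (AddCircle.haarAddCircle (T := (1 : ℝ))) 2 2 (fourierLp 2 (-n))

lemma coeffCLM_apply (m : ℕ) (n : ℤ) (f : L2 m) : coeffCLM m n f = fourierCoeff f n := by
  rw [coeffCLM, ContinuousLinearMap.lpPairing_eq_integral, fourierCoeff]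
  refine integral_congr_ae ?_
  filter_upwards [coeFn_fourierLp (T := (1 : ℝ)) 2 (-n)] with x hx
  rw [hx]
  rfl

/-- The Hardy space `H²` of `ℂᵐ`-valued functions: all Fourier coefficients with negative index
vanish. -/
def H2 (m : ℕ) : Submodule ℂ (L2 m) where
  carrier := {f | ∀ n : ℤ, n < 0 → fourierCoeff f n = 0}
  add_mem' := by
    intro f g hf hg n hn
    have h1 := hf n hn
    have h2 := hg n hn
    rw [← coeffCLM_apply] at h1 h2 ⊢
    rw [map_add, h1, h2, add_zero]
  zero_mem' := by
    intro n _
    rw [← coeffCLM_apply, map_zero]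
  smul_mem' := by
    intro c f hf n hn
    have h1 := hf n hn
    rw [← coeffCLM_apply] at h1 ⊢
    rw [map_smul, h1, smul_zero]

lemma isClosed_H2 (m : ℕ) : IsClosed (H2 m : Set (L2 m)) := by
  have h : (H2 m : Set (L2 m)) = ⋂ n : ℤ, ⋂ _ : n < 0, {f | coeffCLM m n f = 0} := by
    ext f
    simp only [Set.mem_iInter, Set.mem_ofPred_eq, coeffCLM_apply]
    rfl
  rw [h]
  exact isClosed_iInter fun n => isClosed_iInter fun _ =>
    isClosed_eq (coeffCLM m n).continuous continuous_const

instance (m : ℕ) : CompleteSpace (H2 m) := (isClosed_H2 m).completeSpace_coe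

/-- The orthogonal projection `P` of `L²` onto `H²`. -/
def proj (m : ℕ) : L2 m →L[ℂ] H2 m := (H2 m).orthogonalProjectionOnto

/-! ### Multiplication, Toeplitz and Hankel operators -/

/-- The symbol as an operator-valued function on `ℝ/ℤ`. -/
def opSymbol {m : ℕ} (a : Circle → Mat m) (x : UnitAddCircle) : Vec m →L[ℂ] Vec m :=
  Matrix.toEuclideanCLM (𝕜 := ℂ) (a (pt x))

/-- The matrix function `a` belongs to `L^∞`. -/
def MemLInf {m : ℕ} (a : Circle → Mat m) : Prop :=
  MemLp (opSymbol a) ∞ (AddCircle.haarAddCircle (T := (1 : ℝ)))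

open Classical in
/-- Multiplication by the matrix function `a ∈ L^∞` on `L²` (set to `0` if `a ∉ L^∞`). -/
def mulOp {m : ℕ} (a : Circle → Mat m) : L2 m →L[ℂ] L2 m :=
  if h : MemLInf a then
    (ContinuousLinearMap.id ℂ (Vec m →L[ℂ] Vec m)).holderL
      (AddCircle.haarAddCircle (T := (1 : ℝ))) ∞ 2 2 (MemLp.toLp (opSymbol a) h)
  else 0

/-- A scalar function, regarded as the matrix function `u · I`. -/
def scalarSymbol (m : ℕ) (u : Circle → ℂ) : Circle → Mat m := fun t => u t • (1 : Mat m)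

/-- The Toeplitz operator `T(a) f = P (a f)` on `H²`. -/
def toeplitz {m : ℕ} (a : Circle → Mat m) : H2 m →L[ℂ] H2 m :=
  proj m ∘L mulOp a ∘L (H2 m).subtypeL

lemma measurePreserving_neg_circle :
    MeasurePreserving (fun x : UnitAddCircle => -x)
      (AddCircle.haarAddCircle (T := (1 : ℝ))) (AddCircle.haarAddCircle (T := (1 : ℝ))) :=
  Measure.measurePreserving_neg _

/-- The flip operator `(J f)(t) = t⁻¹ f(t⁻¹)` on `L²`. -/
def flip (m : ℕ) : L2 m →L[ℂ] L2 m :=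
  mulOp (scalarSymbol m fun t => ((t⁻¹ : Circle) : ℂ)) ∘L
    (Lp.compMeasurePreservingₗᵢ ℂ (fun x : UnitAddCircle => -x)
      measurePreserving_neg_circle).toContinuousLinearMap

/-- The Hankel operator `H(a) f = P (a · (I - P) J f)` on `H²`. -/
def hankel {m : ℕ} (a : Circle → Mat m) : H2 m →L[ℂ] H2 m :=
  proj m ∘L mulOp a ∘L (1 - (H2 m).starProjection) ∘L flip m ∘L (H2 m).subtypeL

/-- `ã(t) = a(1/t)`. -/
def tilde {m : ℕ} (a : Circle → Mat m) : Circle → Mat m := fun t => a t⁻¹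

/-! ### Model spaces -/

/-- The subspace `u H²` of `H²`. -/
def shiftedH2 (m : ℕ) (u : Circle → ℂ) : Submodule ℂ (H2 m) :=
  ((H2 m).map (mulOp (scalarSymbol m u)).toLinearMap).comap (H2 m).subtype

/-- The model space `K_u = H² ⊖ u H²`. -/
def modelSpace (m : ℕ) (u : Circle → ℂ) : Submodule ℂ (H2 m) := (shiftedH2 m u)ᗮ

instance (m : ℕ) (u : Circle → ℂ) : CompleteSpace (modelSpace m u) :=
  inferInstanceAs (CompleteSpace ((shiftedH2 m u)ᗮ : Submodule ℂ (H2 m)))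

/-- `Q_u = I - P_u`, where `P_u` is the orthogonal projection of `H²` onto `K_u`. -/
def Qu (m : ℕ) (u : Circle → ℂ) : H2 m →L[ℂ] H2 m := 1 - (modelSpace m u).starProjection

/-- The compression `T_u(a) = P_u T(a)|K_u`. -/
def modelToeplitz {m : ℕ} (u : Circle → ℂ) (a : Circle → Mat m) :
    modelSpace m u →L[ℂ] modelSpace m u :=
  (modelSpace m u).orthogonalProjectionOnto ∘L toeplitz a ∘L (modelSpace m u).subtypeL

/-! ### Blaschke products -/

/-- `μ_α(z) = (z - α) / (1 - ᾱ z)`. -/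
def moebius (α z : ℂ) : ℂ := (z - α) / (1 - conj α * z)

lemma norm_moebius (α : 𝔻) (t : Circle) : ‖moebius (α : ℂ) (t : ℂ)‖ = 1 := by
  have ht : (t : ℂ) * conj (t : ℂ) = 1 := by
    rw [Complex.mul_conj, Circle.normSq_coe, Complex.ofReal_one]
  have h1 : (1 - conj (α : ℂ) * t) = t * conj ((t : ℂ) - α) := by
    rw [map_sub, mul_sub, ht]; ring
  have h2 : (t : ℂ) - α ≠ 0 := by
    intro h
    have h3 := α.norm_ne_one
    rw [← sub_eq_zero.mp h] at h3
    exact h3 (Circle.norm_coe t)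
  rw [moebius, h1, norm_div, norm_mul, Circle.norm_coe, one_mul, RCLike.norm_conj]
  exact div_self (norm_ne_zero_iff.mpr h2)

/-- `μ_α` as a map of the unit circle to itself. -/
def moebiusCircle (α : 𝔻) (t : Circle) : Circle :=
  ⟨moebius (α : ℂ) (t : ℂ), mem_sphere_zero_iff_norm.mpr (norm_moebius α t)⟩

open Classical in
/-- The Blaschke factor `B_α`, with `B_0(z) = z`. -/
def blaschkeFactor (α z : ℂ) : ℂ :=
  if α = 0 then z else (-conj α / (‖α‖ : ℂ)) * moebius α z

/-- The boundary function of the finite Blaschke product `B_{α_1} ⋯ B_{α_N}`. -/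
def blaschke {N : ℕ} (α : Fin N → 𝔻) (t : Circle) : ℂ :=
  ∏ j, blaschkeFactor (α j : ℂ) (t : ℂ)

/-! ### The Wiener and Krein algebras and Wiener–Hopf factorizations -/

/-- The Fourier coefficient `a_n` of a matrix function. -/
def coeff {m : ℕ} (a : Circle → Mat m) (n : ℤ) : Mat m :=
  Matrix.of fun i j => fourierCoeff (fun x : UnitAddCircle => a (pt x) i j) n

open scoped Matrix.Norms.Elementwise in
/-- The intersection of the Wiener algebra and the Krein algebra `K^{1/2,1/2}_{2,2}`: continuous
matrix functions with `∑ ‖a_n‖ + ∑ |n| ‖a_n‖² < ∞`. -/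
def MemWK {m : ℕ} (a : Circle → Mat m) : Prop :=
  Continuous a ∧ Summable (fun n : ℤ => ‖coeff a n‖) ∧
    Summable (fun n : ℤ => |(n : ℝ)| * ‖coeff a n‖ ^ 2)

/-- The matrix function `a` belongs to `H^∞`. -/
def MemHInf {m : ℕ} (a : Circle → Mat m) : Prop :=
  MemLInf a ∧ ∀ n : ℤ, n < 0 → coeff a n = 0

/-- Pointwise inverse of a matrix function. -/
def invSymbol {m : ℕ} (a : Circle → Mat m) : Circle → Mat m := fun t => (a t)⁻¹

/-- Entrywise complex conjugate of a matrix function. -/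
def conjSymbol {m : ℕ} (a : Circle → Mat m) : Circle → Mat m := fun t => (a t).map conj

/-- `w` is invertible, and `w` and its inverse belong to `W ∩ K^{1/2,1/2}_{2,2} ∩ H^∞`. -/
structure IsPlusFactor {m : ℕ} (w : Circle → Mat m) : Prop where
  isUnit : ∀ t, IsUnit (w t)
  memWK : MemWK w
  memHInf : MemHInf w
  inv_memWK : MemWK (invSymbol w)
  inv_memHInf : MemHInf (invSymbol w)

/-- `w̄` and its inverse belong to `W ∩ K^{1/2,1/2}_{2,2} ∩ H^∞`. -/
def IsMinusFactor {m : ℕ} (w : Circle → Mat m) : Prop := IsPlusFactor (conjSymbol w)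

/-! ### Geometric mean -/

/-- `g` is the geometric mean `G(φ) = exp((1/2π) ∫₀^{2π} log det φ(e^{iθ}) dθ)`, where `log det φ`
is a continuous logarithm of `det φ` on the circle (it is unique up to an additive constant in
`2πiℤ`, so that `g` does not depend on it). -/
def IsGeometricMean {m : ℕ} (φ : Circle → Mat m) (g : ℂ) : Prop :=
  ∃ L : Circle → ℂ, Continuous L ∧ (∀ t, Complex.exp (L t) = (φ t).det) ∧
    g = Complex.exp ((1 / (2 * (Real.pi : ℂ))) *
      ∫ θ in (0 : ℝ)..(2 * Real.pi), L (Circle.exp θ))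

/-! ### Trace class operators and Fredholm determinants -/

universe u

variable {E : Type u} [NormedAddCommGroup E] [InnerProductSpace ℂ E]

/-- Trace class (nuclear) operators: `A f = ∑ ⟨x_k, f⟩ y_k` with `∑ ‖x_k‖ ‖y_k‖ < ∞`. -/
def IsTraceClass (A : E →L[ℂ] E) : Prop :=
  ∃ x y : ℕ → E, Summable (fun k => ‖x k‖ * ‖y k‖) ∧
    ∀ f, HasSum (fun k => inner ℂ (x k) f • y k) (A f)

open Classical in
/-- `d` is the Fredholm determinant of the operator `T`: `T - I` is of trace class, and in every
orthonormal basis the determinants of the finite sections of `T` converge to `d`. -/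
def HasFredholmDet (T : E →L[ℂ] E) (d : ℂ) : Prop :=
  IsTraceClass (T - 1) ∧
    ∀ (ι : Type u) (e : HilbertBasis ι ℂ E),
      Tendsto (fun S : Finset ι =>
        (Matrix.of fun i j : S => inner ℂ (e i) (T (e j))).det) atTop (𝓝 d)

lemma HasFredholmDet.unique [CompleteSpace E] {T : E →L[ℂ] E} {d d' : ℂ}
    (h : HasFredholmDet T d) (h' : HasFredholmDet T d') : d = d' := by
  obtain ⟨w, e, _⟩ := exists_hilbertBasis ℂ E
  exact tendsto_nhds_unique (h.2 w e) (h'.2 w e)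

end ModelBO

end

noncomputable section

namespace ModelBO

section

/-! ### Hadamard's inequality -/

open scoped ComplexOrder in
lemma norm_det_le_one_of_col {n : Type*} [Fintype n] [DecidableEq n] (M : Matrix n n ℂ)
    (h : ∀ j, ∑ i, ‖M i j‖ ^ 2 ≤ 1) : ‖M.det‖ ≤ 1 := by
  have hp : (M.conjTranspose * M).PosSemidef := Matrix.posSemidef_conjTranspose_mul_self M
  have hdet : (M.conjTranspose * M).det = ((‖M.det‖ ^ 2 : ℝ) : ℂ) := by
    rw [Matrix.det_mul, Matrix.det_conjTranspose, Complex.star_def, Complex.conj_mul']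
    push_cast; rfl
  have htr : (M.conjTranspose * M).trace = ((∑ j, ∑ i, ‖M i j‖ ^ 2 : ℝ) : ℂ) := by
    simp only [Matrix.trace, Matrix.diag, Matrix.mul_apply, Matrix.conjTranspose_apply,
      Complex.star_def, Complex.conj_mul']
    push_cast; rfl
  rw [hp.isHermitian.det_eq_prod_eigenvalues] at hdet
  rw [hp.isHermitian.trace_eq_sum_eigenvalues] at htr
  have hdet' : ∏ i, hp.isHermitian.eigenvalues i = ‖M.det‖ ^ 2 := by
    apply Complex.ofReal_injective
    rw [← hdet, Complex.ofReal_prod]; rfl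
  have htr' : ∑ i, hp.isHermitian.eigenvalues i = ∑ j, ∑ i, ‖M i j‖ ^ 2 := by
    apply Complex.ofReal_injective
    rw [← htr, Complex.ofReal_sum]; rfl
  have h1 : ∏ i, hp.isHermitian.eigenvalues i ≤ 1 := by
    calc ∏ i, hp.isHermitian.eigenvalues i
        ≤ ∏ i, Real.exp (hp.isHermitian.eigenvalues i - 1) :=
          Finset.prod_le_prod (fun i _ => hp.eigenvalues_nonneg i)
            fun i _ => by linarith [Real.add_one_le_exp (hp.isHermitian.eigenvalues i - 1)]
      _ = Real.exp (∑ i, (hp.isHermitian.eigenvalues i - 1)) := (Real.exp_sum _ _).symm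
      _ ≤ 1 := by
          rw [Real.exp_le_one_iff, Finset.sum_sub_distrib, htr', ← Finset.sum_sub_distrib]
          exact Finset.sum_nonpos fun j _ => by linarith [h j]
  rw [hdet'] at h1
  exact (sq_le_one_iff₀ (norm_nonneg _)).mp h1

section Det

universe u

variable {E : Type u} [NormedAddCommGroup E] [InnerProductSpace ℂ E]

lemma norm_det_inner_le_one {n : Type*} [Fintype n] [DecidableEq n] (x y : n → E)
    (hx : ∀ i, ‖x i‖ ≤ 1) (hy : ∀ i, ‖y i‖ ≤ 1) :
    ‖(Matrix.of fun i j => inner ℂ (x i) (y j)).det‖ ≤ 1 := by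
  by_cases hli : LinearIndependent ℂ x
  · have hfin : Module.finrank ℂ (Submodule.span ℂ (Set.range x)) = Fintype.card n :=
      finrank_span_eq_card hli
    have : FiniteDimensional ℂ (Submodule.span ℂ (Set.range x)) :=
      FiniteDimensional.span_of_finite ℂ (Set.finite_range x)
    let b : OrthonormalBasis n ℂ (Submodule.span ℂ (Set.range x)) :=
      ((stdOrthonormalBasis ℂ (Submodule.span ℂ (Set.range x))).reindex
        (finCongr hfin)).reindex (Fintype.equivFin n).symm
    have hb : Orthonormal ℂ (fun k => (b k : E)) :=
      b.orthonormal.comp_linearIsometry (Submodule.subtypeₗᵢ _)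
    have hxe : ∀ i, x i = ∑ k, (inner ℂ (b k : E) (x i)) • (b k : E) := by
      intro i
      have := b.sum_repr ⟨x i, Submodule.subset_span ⟨i, rfl⟩⟩
      have h2 := congrArg (Subtype.val) this
      simp only [b.repr_apply_apply, Submodule.coe_sum, Submodule.coe_smul,
        Submodule.coe_inner] at h2
      exact h2.symm
    have hM : (Matrix.of fun i j => inner ℂ (x i) (y j)) =
        (Matrix.of fun k i => inner ℂ (b k : E) (x i)).conjTranspose *
          (Matrix.of fun k j => inner ℂ (b k : E) (y j)) := by
      ext i j
      rw [Matrix.mul_apply]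
      simp only [Matrix.of_apply, Matrix.conjTranspose_apply]
      conv_lhs => rw [hxe i]
      rw [sum_inner]
      refine Finset.sum_congr rfl fun k _ => ?_
      rw [inner_smul_left]; rfl
    have key : ∀ z : n → E, (∀ i, ‖z i‖ ≤ 1) →
        ‖(Matrix.of fun k i => inner ℂ (b k : E) (z i)).det‖ ≤ 1 := by
      intro z hz
      refine norm_det_le_one_of_col _ fun j => ?_
      calc _ ≤ ‖z j‖ ^ 2 := hb.sum_inner_products_le (z j) (s := Finset.univ)
        _ ≤ 1 := pow_le_one₀ (norm_nonneg _) (hz j)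
    rw [hM, Matrix.det_mul, Matrix.det_conjTranspose, norm_mul, norm_star]
    exact mul_le_one₀ (key x hx) (norm_nonneg _) (key y hy)
  · rw [Fintype.not_linearIndependent_iff] at hli
    obtain ⟨g, hg, i, hi⟩ := hli
    have : (Matrix.of fun i j => inner ℂ (x i) (y j)).det = 0 := by
      rw [← Matrix.exists_vecMul_eq_zero_iff]
      refine ⟨fun i => conj (g i), fun h => hi ?_, ?_⟩
      · simpa using congrFun h i
      · ext j
        simp only [Matrix.vecMul, dotProduct, Matrix.of_apply, Pi.zero_apply]
        simp_rw [← inner_smul_left]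
        rw [← sum_inner, hg, inner_zero_left]
    rw [this, norm_zero]; exact zero_le_one

/-- Hadamard's inequality for the determinant of a matrix of inner products. -/
lemma norm_det_inner_le {n : Type*} [Fintype n] [DecidableEq n] (x y : n → E) :
    ‖(Matrix.of fun i j => inner ℂ (x i) (y j)).det‖ ≤ ∏ i, (‖x i‖ * ‖y i‖) := by
  have hs : ∀ z : E, z = (‖z‖ : ℂ) • ((‖z‖⁻¹ : ℝ) : ℂ) • z := by
    intro z
    by_cases hz : z = 0
    · simp [hz]
    · rw [smul_smul, ← Complex.ofReal_mul, mul_inv_cancel₀ (norm_ne_zero_iff.mpr hz)]; simp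
  have hn : ∀ z : E, ‖((‖z‖⁻¹ : ℝ) : ℂ) • z‖ ≤ 1 := by
    intro z
    rw [norm_smul, Complex.norm_real, norm_inv, norm_norm]
    exact inv_mul_le_one_of_le₀ le_rfl (norm_nonneg _)
  have hM : (Matrix.of fun i j => inner ℂ (x i) (y j)) =
      Matrix.of fun i j => (‖x i‖ : ℂ) * (Matrix.of fun i j => (‖y j‖ : ℂ) *
        (Matrix.of fun i j => inner ℂ (((‖x i‖⁻¹ : ℝ) : ℂ) • x i)
          (((‖y j‖⁻¹ : ℝ) : ℂ) • y j)) i j) i j := by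
    ext i j
    simp only [Matrix.of_apply]
    conv_lhs => rw [hs (x i), hs (y j)]
    rw [inner_smul_left, inner_smul_right, Complex.conj_ofReal]
  rw [hM, Matrix.det_mul_column, Matrix.det_mul_row, norm_mul, norm_mul, ← mul_assoc,
    Finset.prod_mul_distrib]
  have := norm_det_inner_le_one (fun i => ((‖x i‖⁻¹ : ℝ) : ℂ) • x i)
    (fun j => ((‖y j‖⁻¹ : ℝ) : ℂ) • y j) (fun i => hn _) (fun i => hn _)
  simp only [norm_prod, Complex.norm_real, norm_norm]
  exact mul_le_of_le_one_right
    (mul_nonneg (Finset.prod_nonneg fun _ _ => norm_nonneg _)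
      (Finset.prod_nonneg fun _ _ => norm_nonneg _)) this

/-! ### The determinant of a nuclear representation -/

open Classical in
/-- The Fredholm series of the operator `I + ∑ ⟨x_k, ·⟩ y_k`: the sum of all finite principal
minors of the matrix `⟨x_k, y_l⟩`. -/
def fredholmSeries {κ : Type*} (x y : κ → E) : ℂ :=
  ∑' T : Finset κ, (Matrix.of fun k l : T => inner ℂ (x k) (y l)).det

open Classical in
lemma norm_minor_le {κ : Type*} (x y : κ → E) (T : Finset κ) :
    ‖(Matrix.of fun k l : T => inner ℂ (x k) (y l)).det‖ ≤ ∏ k ∈ T, (‖x k‖ * ‖y k‖) := by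
  refine (norm_det_inner_le (fun k : T => x k) (fun k : T => y k)).trans_eq ?_
  exact Finset.prod_coe_sort T (fun k => ‖x k‖ * ‖y k‖)

/-- The Fredholm series depends continuously on the vectors under a summable bound. -/
lemma tendsto_fredholmSeries {κ β : Type*} {l : Filter β} {xs ys : β → κ → E} {x y : κ → E}
    {X Y : κ → ℝ} (hX : ∀ b k, ‖xs b k‖ ≤ X k) (hY : ∀ b k, ‖ys b k‖ ≤ Y k)
    (hXY : Summable fun k => X k * Y k)
    (hx : ∀ k, Tendsto (fun b => xs b k) l (𝓝 (x k)))
    (hy : ∀ k, Tendsto (fun b => ys b k) l (𝓝 (y k))) :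
    Tendsto (fun b => fredholmSeries (xs b) (ys b)) l (𝓝 (fredholmSeries x y)) := by
  classical
  rcases isEmpty_or_nonempty β with hβ | ⟨⟨b₀⟩⟩
  · rw [Subsingleton.elim l ⊥]; exact tendsto_bot
  have hX0 : ∀ k, 0 ≤ X k := fun k => (norm_nonneg _).trans (hX b₀ k)
  have hY0 : ∀ k, 0 ≤ Y k := fun k => (norm_nonneg _).trans (hY b₀ k)
  refine tendsto_tsum_of_dominated_convergence
    (summable_finsetProd_of_summable_nonneg (fun k => mul_nonneg (hX0 k) (hY0 k)) hXY) ?_ ?_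
  · intro T
    have hc : Continuous fun M : Matrix T T ℂ => M.det := continuous_id.matrix_det
    refine (hc.tendsto _).comp ?_
    refine tendsto_pi_nhds.mpr fun k => tendsto_pi_nhds.mpr fun j => ?_
    exact (hx k).inner (hy j)
  · refine Eventually.of_forall fun b T => (norm_minor_le _ _ T).trans ?_
    exact Finset.prod_le_prod (fun k _ => by positivity) fun k _ =>
      mul_le_mul (hX b k) (hY b k) (norm_nonneg _) (hX0 k)

lemma sum_principal_minors {n R : Type*} [Fintype n] [DecidableEq n] [CommRing R]
    (M : Matrix n n R) :
    (1 + M).det = ∑ s : Finset n, (M.submatrix (fun i : s => (i : n)) (fun i : s => (i : n))).det := by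
  rw [add_comm]
  have := (Matrix.detRowAlternating (n := n) (R := R)).map_add_univ M.row (1 : Matrix n n R).row
  refine Eq.trans this ?_
  exact Finset.sum_congr rfl fun s _ => Matrix.det_piecewise_one_eq_submatrix_det M s

lemma fredholmSeries_fintype {κ : Type*} [Fintype κ] [DecidableEq κ] (x y : κ → E) :
    fredholmSeries x y = (1 + Matrix.of fun k l => inner ℂ (x k) (y l)).det := by
  rw [fredholmSeries, tsum_fintype, sum_principal_minors]
  refine Finset.sum_congr rfl fun s _ => ?_
  congr!

/-- Indices for which the left vector vanishes may be dropped. -/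
lemma fredholmSeries_of_support {κ : Type*} (x y : κ → E) (F : Finset κ)
    (hF : ∀ k ∉ F, x k = 0) :
    fredholmSeries x y = fredholmSeries (fun k : F => x k) (fun k : F => y k) := by
  classical
  have hinj : Function.Injective (fun T : Finset F => T.map (Function.Embedding.subtype _)) :=
    Finset.map_injective _
  rw [fredholmSeries, fredholmSeries]
  symm
  refine Eq.trans ?_ (hinj.tsum_eq ?_)
  · refine tsum_congr fun T => ?_
    let e : T ≃ (T.map (Function.Embedding.subtype (· ∈ F)) : Finset κ) :=
      Equiv.ofBijective
        (fun k => ⟨((k : F) : κ), Finset.mem_map_of_mem (Function.Embedding.subtype _) k.2⟩)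
        ⟨fun k l hkl => Subtype.ext (Subtype.ext (congrArg
          (fun z : (T.map (Function.Embedding.subtype (· ∈ F)) : Finset κ) => (z : κ)) hkl)),
        fun ⟨k, hk⟩ => by
          obtain ⟨l, hl, rfl⟩ := Finset.mem_map.mp hk
          exact ⟨⟨l, hl⟩, rfl⟩⟩
    rw [← Matrix.det_submatrix_equiv_self e]
    congr!
  · intro T hT
    have hsub : T ⊆ F := by
      intro k hk
      by_contra hkF
      refine hT (Matrix.det_eq_zero_of_row_eq_zero (⟨k, hk⟩ : T) fun j => ?_)
      simp [hF k hkF]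
    refine ⟨T.subtype (· ∈ F), ?_⟩
    simp only [Finset.subtype_map]
    exact Finset.filter_true_of_mem hsub

/-- `K = ∑ ⟨x_k, ·⟩ y_k` is a nuclear representation of the operator `K`. -/
structure IsNuclearRep {κ : Type*} (x y : κ → E) (K : E →L[ℂ] E) : Prop where
  summable : Summable fun k => ‖x k‖ * ‖y k‖
  hasSum : ∀ f, HasSum (fun k => inner ℂ (x k) f • y k) (K f)

lemma IsNuclearRep.isTraceClass {κ : Type*} [Countable κ] {x y : κ → E} {K : E →L[ℂ] E}
    (h : IsNuclearRep x y K) : IsTraceClass K := by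
  obtain ⟨φ, hφ⟩ := Countable.exists_injective_nat κ
  refine ⟨Function.extend φ x 0, Function.extend φ y 0, ?_, fun f => ?_⟩
  · rw [← hφ.summable_iff]
    · convert h.summable using 2 with k
      simp [hφ.extend_apply]
    · intro k hk
      simp [Function.extend_apply' _ _ _ hk]
  · rw [← hφ.hasSum_iff]
    · convert h.hasSum f using 2 with k
      simp [hφ.extend_apply]
    · intro k hk
      simp [Function.extend_apply' _ _ _ hk]

lemma IsNuclearRep.add {κ κ' : Type*} {x y : κ → E} {x' y' : κ' → E} {K L : E →L[ℂ] E}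
    (hK : IsNuclearRep x y K) (hL : IsNuclearRep x' y' L) :
    IsNuclearRep (Sum.elim x x') (Sum.elim y y') (K + L) where
  summable := by
    refine Summable.sum _ ?_ ?_
    · exact hK.summable
    · exact hL.summable
  hasSum f := by
    refine HasSum.sum (M := E) ?_ ?_
    · exact hK.hasSum f
    · exact hL.hasSum f

lemma IsNuclearRep.comp_left {κ : Type*} {x y : κ → E} {K : E →L[ℂ] E}
    (hK : IsNuclearRep x y K) (M : E →L[ℂ] E) :
    IsNuclearRep x (fun k => M (y k)) (M ∘L K) where
  summable := by
    refine Summable.of_nonneg_of_le (fun k => by positivity) (fun k => ?_)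
      (hK.summable.mul_left ‖M‖)
    calc ‖x k‖ * ‖M (y k)‖ ≤ ‖x k‖ * (‖M‖ * ‖y k‖) := by gcongr; exact M.le_opNorm _
      _ = ‖M‖ * (‖x k‖ * ‖y k‖) := by ring
  hasSum f := by simpa using M.hasSum (hK.hasSum f)

section Complete

variable [CompleteSpace E]

lemma IsNuclearRep.comp_right {κ : Type*} {x y : κ → E} {K : E →L[ℂ] E}
    (hK : IsNuclearRep x y K) (M : E →L[ℂ] E) :
    IsNuclearRep (fun k => ContinuousLinearMap.adjoint M (x k)) y (K ∘L M) where
  summable := by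
    refine Summable.of_nonneg_of_le (fun k => by positivity) (fun k => ?_)
      (hK.summable.mul_left ‖ContinuousLinearMap.adjoint M‖)
    rw [← mul_assoc]
    gcongr
    exact ContinuousLinearMap.le_opNorm _ _
  hasSum f := by simpa [ContinuousLinearMap.adjoint_inner_left] using hK.hasSum (M f)

end Complete

/-! ### Finite sections -/

/-- The orthogonal projection onto the span of the vectors `e i`, `i ∈ S`, of an orthonormal
family. -/
def sectionProj {ι : Type*} (e : ι → E) (S : Finset ι) : E →L[ℂ] E :=
  ∑ i ∈ S, (innerSL ℂ (e i)).smulRight (e i)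

lemma sectionProj_apply {ι : Type*} (e : ι → E) (S : Finset ι) (z : E) :
    sectionProj e S z = ∑ i ∈ S, inner ℂ (e i) z • e i := by
  simp [sectionProj]

lemma inner_sectionProj {ι : Type*} (e : ι → E) (S : Finset ι) (x y : E) :
    inner ℂ (sectionProj e S x) y = ∑ i ∈ S, inner ℂ x (e i) * inner ℂ (e i) y := by
  rw [sectionProj_apply, sum_inner]
  refine Finset.sum_congr rfl fun i _ => ?_
  rw [inner_smul_left, inner_conj_symm]

lemma norm_sectionProj_le {ι : Type*} {e : ι → E} (he : Orthonormal ℂ e) (S : Finset ι) (z : E) :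
    ‖sectionProj e S z‖ ≤ ‖z‖ := by
  have h : ‖sectionProj e S z‖ ^ 2 = ∑ i ∈ S, ‖inner ℂ (e i) z‖ ^ 2 := by
    rw [sectionProj_apply, ← @inner_self_eq_norm_sq ℂ, he.inner_sum]
    simp only [Complex.conj_mul', map_sum]
    exact Finset.sum_congr rfl fun i _ => by
      rw [← Complex.ofReal_pow]; exact Complex.ofReal_re _
  refine (sq_le_sq₀ (norm_nonneg _) (norm_nonneg _)).mp ?_
  rw [h]
  exact he.sum_inner_products_le z

lemma tendsto_sectionProj {ι : Type*} (e : HilbertBasis ι ℂ E) (z : E) :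
    Tendsto (fun S => sectionProj e S z) atTop (𝓝 z) := by
  simp_rw [sectionProj_apply, ← e.repr_apply_apply]
  exact e.hasSum_repr z

open Classical in
lemma det_section {ι κ : Type*} {e : ι → E} (he : Orthonormal ℂ e) (S : Finset ι)
    {x y : κ → E} {K : E →L[ℂ] E} (hK : IsNuclearRep x y K) :
    (Matrix.of fun i j : S => inner ℂ (e i) ((1 + K) (e j))).det =
      fredholmSeries (fun k => sectionProj e S (x k)) y := by
  let xs : Finset κ → κ → E := fun F k => if k ∈ F then sectionProj e S (x k) else 0
  have h1 : Tendsto (fun F => fredholmSeries (xs F) y) atTop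
      (𝓝 (fredholmSeries (fun k => sectionProj e S (x k)) y)) := by
    refine tendsto_fredholmSeries (X := fun k => ‖x k‖) (Y := fun k => ‖y k‖) ?_
      (fun _ _ => le_rfl) hK.summable (fun k => ?_) (fun k => tendsto_const_nhds)
    · intro F k
      by_cases hk : k ∈ F
      · simpa [xs, hk] using norm_sectionProj_le he S (x k)
      · simp [xs, hk]
    · refine tendsto_const_nhds.congr' ?_
      filter_upwards [eventually_ge_atTop {k}] with F hF
      simp [xs, Finset.singleton_subset_iff.mp hF]
  have h2 : ∀ F, fredholmSeries (xs F) y = (Matrix.of fun i j : S =>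
      inner ℂ (e i) (e j) + ∑ k ∈ F, inner ℂ (x k) (e j) * inner ℂ (e i) (y k)).det := by
    intro F
    rw [fredholmSeries_of_support _ _ F (fun k hk => by simp [xs, hk]), fredholmSeries_fintype]
    have hA : (Matrix.of fun k l : F => inner ℂ (xs F k) (y l)) =
        (Matrix.of fun (k : F) (j : S) => inner ℂ (x k) (e j)) *
          (Matrix.of fun (i : S) (k : F) => inner ℂ (e i) (y k)) := by
      ext k l
      rw [Matrix.mul_apply]
      simp only [Matrix.of_apply, xs, k.2, if_true, inner_sectionProj]
      exact (Finset.sum_coe_sort S (fun i => inner ℂ (x k) (e i) * inner ℂ (e i) (y l))).symm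
    rw [hA, Matrix.det_one_add_mul_comm]
    congr 1
    ext i j
    rw [Matrix.add_apply, Matrix.mul_apply, Matrix.of_apply]
    congr 1
    · rw [orthonormal_iff_ite.mp he, Matrix.one_apply]
      simp only [Subtype.ext_iff]
    · simp only [Matrix.of_apply]
      rw [← Finset.sum_coe_sort F]
      exact Finset.sum_congr rfl fun k _ => mul_comm _ _
  have h3 : Tendsto (fun F => fredholmSeries (xs F) y) atTop
      (𝓝 (Matrix.of fun i j : S => inner ℂ (e i) ((1 + K) (e j))).det) := by
    simp_rw [h2]
    have hc : Continuous fun M : Matrix S S ℂ => M.det := continuous_id.matrix_det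
    refine (hc.tendsto _).comp ?_
    refine tendsto_pi_nhds.mpr fun i => tendsto_pi_nhds.mpr fun j => ?_
    simp only [Matrix.of_apply, add_apply, one_apply_eq_self,
      inner_add_right]
    refine tendsto_const_nhds.add ?_
    have := (innerSL ℂ (e i)).hasSum (hK.hasSum (e j))
    simpa using! this
  exact tendsto_nhds_unique h3 h1

lemma IsNuclearRep.hasFredholmDet {κ : Type*} [Countable κ] {x y : κ → E} {K : E →L[ℂ] E}
    (hK : IsNuclearRep x y K) : HasFredholmDet (1 + K) (fredholmSeries x y) := by
  classical
  refine ⟨by rw [add_sub_cancel_left]; exact hK.isTraceClass, fun ι e => ?_⟩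
  have : Tendsto (fun S => fredholmSeries (fun k => sectionProj e S (x k)) y) atTop
      (𝓝 (fredholmSeries x y)) :=
    tendsto_fredholmSeries (X := fun k => ‖x k‖) (Y := fun k => ‖y k‖)
      (fun S k => norm_sectionProj_le e.orthonormal S (x k))
      (fun _ _ => le_rfl) hK.summable (fun k => tendsto_sectionProj e (x k))
      (fun k => tendsto_const_nhds)
  refine this.congr fun S => ?_
  rw [← det_section e.orthonormal S hK]

lemma exists_hasFredholmDet {T : E →L[ℂ] E} (h : IsTraceClass (T - 1)) :
    ∃ d, HasFredholmDet T d := by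
  obtain ⟨x, y, hs, hf⟩ := h
  have := (IsNuclearRep.mk hs hf).hasFredholmDet
  rw [add_sub_cancel] at this
  exact ⟨_, this⟩

lemma adjoint_sectionProj [CompleteSpace E] {ι : Type*} (e : ι → E) (S : Finset ι) :
    ContinuousLinearMap.adjoint (sectionProj e S) = sectionProj e S := by
  symm
  rw [ContinuousLinearMap.eq_adjoint_iff]
  intro x y
  rw [inner_sectionProj, sectionProj_apply, inner_sum]
  exact Finset.sum_congr rfl fun i _ => by rw [inner_smul_right, mul_comm]

open Classical in
lemma section_mul {ι : Type*} {e : ι → E} (he : Orthonormal ℂ e) (S : Finset ι)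
    (K L : E →L[ℂ] E) :
    (Matrix.of fun i j : S => inner ℂ (e i) ((1 + K) (e j))) *
        (Matrix.of fun i j : S => inner ℂ (e i) ((1 + L) (e j))) =
      Matrix.of fun i j : S =>
        inner ℂ (e i) ((1 + (K + L + K ∘L sectionProj e S ∘L L)) (e j)) := by
  ext i l
  rw [Matrix.mul_apply]
  simp only [Matrix.of_apply]
  have hl : sectionProj e S (e l) = e l := by
    rw [sectionProj_apply, Finset.sum_eq_single (l : ι)]
    · rw [orthonormal_iff_ite.mp he, if_pos rfl, one_smul]
    · intro j _ hj
      rw [orthonormal_iff_ite.mp he, if_neg hj, zero_smul]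
    · intro h; exact absurd l.2 h
  have h3 : ∑ j : S, inner ℂ (e i) ((1 + K) (e j)) * inner ℂ (e j) ((1 + L) (e l)) =
      inner ℂ (e i) ((1 + K) (sectionProj e S ((1 + L) (e l)))) := by
    rw [sectionProj_apply, map_sum, inner_sum, ← Finset.sum_coe_sort S]
    refine Finset.sum_congr rfl fun j _ => ?_
    rw [map_smul, inner_smul_right, mul_comm]
  have h4 : ∀ z, inner ℂ (e i) (sectionProj e S z) = inner ℂ (e i) z := by
    intro z
    rw [sectionProj_apply, inner_sum, Finset.sum_eq_single (i : ι)]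
    · rw [inner_smul_right, orthonormal_iff_ite.mp he, if_pos rfl, mul_one]
    · intro j _ hj
      rw [inner_smul_right, orthonormal_iff_ite.mp he, if_neg (Ne.symm hj), mul_zero]
    · intro h; exact absurd i.2 h
  rw [h3]
  simp only [add_apply, one_apply_eq_self, map_add, ContinuousLinearMap.comp_apply,
    inner_add_right, h4, hl]
  ring

open Classical in
lemma det_section_mul [CompleteSpace E] {ι κ κ' : Type*} {e : ι → E} (he : Orthonormal ℂ e)
    (S : Finset ι) {x y : κ → E} {x' y' : κ' → E} {K L : E →L[ℂ] E}
    (hK : IsNuclearRep x y K) (hL : IsNuclearRep x' y' L) :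
    (Matrix.of fun i j : S => inner ℂ (e i) ((1 + K) (e j))).det *
        (Matrix.of fun i j : S => inner ℂ (e i) ((1 + L) (e j))).det =
      fredholmSeries (Sum.elim (Sum.elim (fun k => sectionProj e S (x k))
          fun k => sectionProj e S (x' k))
        fun k => sectionProj e S (ContinuousLinearMap.adjoint L (sectionProj e S (x k))))
        (Sum.elim (Sum.elim y y') y) := by
  have hmid := hK.comp_right (sectionProj e S ∘L L)
  simp only [ContinuousLinearMap.adjoint_comp, adjoint_sectionProj,
    ContinuousLinearMap.comp_apply] at hmid
  rw [← Matrix.det_mul, section_mul he, det_section he S ((hK.add hL).add hmid)]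
  congr 1
  funext k
  rcases k with (k | k) | k <;> rfl

/-- The Fredholm determinant is multiplicative. -/
theorem HasFredholmDet.mul [CompleteSpace E] {A B : E →L[ℂ] E} {d d' : ℂ}
    (hA : HasFredholmDet A d) (hB : HasFredholmDet B d') : HasFredholmDet (A ∘L B) (d * d') := by
  classical
  obtain ⟨x, y, hs, hf⟩ := hA.1
  obtain ⟨x', y', hs', hf'⟩ := hB.1
  have hK : IsNuclearRep x y (A - 1) := ⟨hs, hf⟩
  have hL : IsNuclearRep x' y' (B - 1) := ⟨hs', hf'⟩
  set K := A - 1 with hKd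
  set L := B - 1 with hLd
  have hAK : A = 1 + K := by rw [hKd]; abel
  have hBL : B = 1 + L := by rw [hLd]; abel
  have hrep := (hK.add hL).add (hK.comp_right L)
  have hprod : A ∘L B = 1 + (K + L + K ∘L L) := by
    rw [hAK, hBL]; ext f; simp; abel
  have hdet := hrep.hasFredholmDet
  rw [← hprod] at hdet
  suffices h : d * d' = fredholmSeries (Sum.elim (Sum.elim x x')
      fun k => ContinuousLinearMap.adjoint L (x k)) (Sum.elim (Sum.elim y y') y) by
    rw [h]; exact hdet
  obtain ⟨w, e, _⟩ := exists_hilbertBasis ℂ E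
  have h1 := (hA.2 w e).mul (hB.2 w e)
  refine tendsto_nhds_unique h1 ?_
  have hsec := fun S : Finset w => det_section_mul e.orthonormal S hK hL
  rw [← hAK, ← hBL] at hsec
  simp_rw [hsec]
  have hrep' : Summable fun k : (ℕ ⊕ ℕ) ⊕ ℕ =>
      Sum.elim (Sum.elim (fun k => ‖x k‖) fun k => ‖x' k‖)
        (fun k => ‖ContinuousLinearMap.adjoint L‖ * ‖x k‖) k *
      Sum.elim (Sum.elim (fun k => ‖y k‖) fun k => ‖y' k‖) (fun k => ‖y k‖) k := by
    refine Summable.sum _ (Summable.sum _ ?_ ?_) ?_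
    · exact hs
    · exact hs'
    · simpa [Function.comp_def, mul_assoc] using hs.mul_left ‖ContinuousLinearMap.adjoint L‖
  refine tendsto_fredholmSeries ?_ ?_ hrep' ?_ (fun k => tendsto_const_nhds)
  · rintro S ((k | k) | k)
    · exact norm_sectionProj_le e.orthonormal S _
    · exact norm_sectionProj_le e.orthonormal S _
    · refine (norm_sectionProj_le e.orthonormal S _).trans
        ((ContinuousLinearMap.le_opNorm _ _).trans ?_)
      exact mul_le_mul_of_nonneg_left (norm_sectionProj_le e.orthonormal S _) (norm_nonneg _)
  · rintro S ((k | k) | k) <;> exact le_rfl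
  · rintro ((k | k) | k)
    · exact tendsto_sectionProj e _
    · exact tendsto_sectionProj e _
    · have ht := tendsto_sectionProj e (ContinuousLinearMap.adjoint L (x k))
      have ht' := ((ContinuousLinearMap.adjoint L).continuous.tendsto _).comp
        (tendsto_sectionProj e (x k))
      have hz : Tendsto (fun S => sectionProj e S (ContinuousLinearMap.adjoint L
          (sectionProj e S (x k)) - ContinuousLinearMap.adjoint L (x k))) atTop (𝓝 0) := by
        refine squeeze_zero_norm (fun S => norm_sectionProj_le e.orthonormal S _) ?_
        have := (ht'.sub_const (ContinuousLinearMap.adjoint L (x k))).norm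
        simpa using this
      have := hz.add ht
      simp only [zero_add] at this
      refine this.congr fun S => ?_
      rw [map_sub, sub_add_cancel]
      rfl

end Det

end

section

section Jacobi

universe u

variable {E : Type u} [NormedAddCommGroup E] [InnerProductSpace ℂ E]

lemma IsTraceClass.comp_left {K : E →L[ℂ] E} (hK : IsTraceClass K) (M : E →L[ℂ] E) :
    IsTraceClass (M ∘L K) := by
  obtain ⟨x, y, hs, hf⟩ := hK
  exact ((IsNuclearRep.mk hs hf).comp_left M).isTraceClass

lemma IsTraceClass.comp_right [CompleteSpace E] {K : E →L[ℂ] E} (hK : IsTraceClass K) (M : E →L[ℂ] E) :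
    IsTraceClass (K ∘L M) := by
  obtain ⟨x, y, hs, hf⟩ := hK
  exact ((IsNuclearRep.mk hs hf).comp_right M).isTraceClass

lemma isNuclearRep_starProjection {n : Type*} [Fintype n] (W : Submodule ℂ E)
    [W.HasOrthogonalProjection] (b : OrthonormalBasis n ℂ W) :
    IsNuclearRep (fun k => (b k : E)) (fun k => (b k : E)) W.starProjection where
  summable := (hasSum_fintype _).summable
  hasSum f := by
    convert hasSum_fintype _ using 1
    rw [← Submodule.coe_orthogonalProjectionOnto_apply]
    conv_lhs => rw [← b.sum_repr (W.orthogonalProjectionOnto f)]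
    rw [Submodule.coe_sum]
    refine Finset.sum_congr rfl fun k _ => ?_
    rw [b.repr_apply_apply, Submodule.coe_smul,
      Submodule.inner_orthogonalProjectionOnto_eq_of_mem_left]

/-- Jacobi's identity for the complementary minor of an inverse. -/
theorem exists_hasFredholmDet_jacobi [CompleteSpace E] (W : Submodule ℂ E) [FiniteDimensional ℂ W]
    {K B : E →L[ℂ] E} (hK : IsTraceClass K) (hAB : (1 - K) ∘L B = 1) (hBA : B ∘L (1 - K) = 1) :
    ∃ dQ d : ℂ,
      HasFredholmDet (1 - (1 - W.starProjection) ∘L K ∘L (1 - W.starProjection)) dQ ∧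
      HasFredholmDet (1 - K) d ∧ d ≠ 0 ∧
      LinearMap.det (W.orthogonalProjectionOnto ∘L B ∘L W.subtypeL).toLinearMap = dQ / d := by
  have hneg : IsTraceClass ((1 - K) - 1) := by
    have := hK.comp_left (-1 : E →L[ℂ] E)
    convert this using 1
    ext f; simp
  obtain ⟨d, hd⟩ := exists_hasFredholmDet hneg
  have hnegQ : IsTraceClass
      ((1 - (1 - W.starProjection) ∘L K ∘L (1 - W.starProjection)) - 1) := by
    have := (hK.comp_left (-(1 - W.starProjection))).comp_right (1 - W.starProjection)
    convert this using 1
    ext f; simp; abel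
  obtain ⟨dQ, hdQ⟩ := exists_hasFredholmDet hnegQ
  have hB : IsTraceClass (B - 1) := by
    have := hK.comp_left B
    convert this using 1
    rw [← hBA]; ext f; simp
  obtain ⟨dB, hdB⟩ := exists_hasFredholmDet hB
  have hone : HasFredholmDet (1 : E →L[ℂ] E) 1 := by
    have h0 : IsNuclearRep (fun _ : Fin 0 => (0 : E)) (fun _ => 0) (0 : E →L[ℂ] E) :=
      ⟨(hasSum_fintype _).summable, fun f => by simp⟩
    have := h0.hasFredholmDet
    rwa [add_zero, fredholmSeries_fintype, Matrix.det_isEmpty] at this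
  have hd0 : d ≠ 0 := by
    have h1 := hd.mul hdB
    rw [hAB] at h1
    intro h
    have := h1.unique hone
    rw [h, zero_mul] at this
    exact zero_ne_one this
  refine ⟨dQ, d, hdQ, hd, hd0, ?_⟩
  let b := stdOrthonormalBasis ℂ W
  have hP := isNuclearRep_starProjection W b
  have hPb : ∀ k, W.starProjection (b k : E) = b k :=
    fun k => Submodule.starProjection_eq_self_iff.mpr (b k).2
  have hbP : ∀ k z, inner ℂ (b k : E) (W.starProjection z) = inner ℂ (b k : E) z := fun k z => by
    rw [← Submodule.inner_starProjection_left_eq_right, hPb]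
  have hbb : ∀ k l, inner ℂ (b k : E) (b l : E) = if k = l then (1 : ℂ) else 0 := fun k l => by
    rw [← Submodule.coe_inner]; exact orthonormal_iff_ite.mp b.orthonormal k l
  set P := W.starProjection with hPdef
  have hPP : ∀ z, P (P z) = P z := fun z =>
    Submodule.starProjection_eq_self_iff.mpr (Submodule.starProjection_apply_mem W z)
  have hcorner : HasFredholmDet (1 + (P ∘L B - 1) ∘L P)
      (LinearMap.det (W.orthogonalProjectionOnto ∘L B ∘L W.subtypeL).toLinearMap) := by
    have h := (hP.comp_left (P ∘L B - 1)).hasFredholmDet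
    rw [fredholmSeries_fintype] at h
    convert h using 1
    rw [← LinearMap.det_toMatrix b.toBasis]
    congr 1
    ext k l
    rw [LinearMap.toMatrix_apply, Matrix.add_apply, Matrix.of_apply]
    simp only [OrthonormalBasis.coe_toBasis, OrthonormalBasis.coe_toBasis_repr_apply,
      b.repr_apply_apply, sub_apply, one_apply_eq_self, ContinuousLinearMap.comp_apply,
      inner_sub_right, hbP, hbb, Matrix.one_apply, ContinuousLinearMap.coe_coe]
    rw [Submodule.coe_inner, Submodule.coe_orthogonalProjectionOnto_apply, hbP]
    simp
  have hlow : HasFredholmDet (1 + ((1 - P) ∘L (1 - K)) ∘L P) 1 := by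
    have h := (hP.comp_left ((1 - P) ∘L (1 - K))).hasFredholmDet
    rw [fredholmSeries_fintype] at h
    convert h using 1
    symm
    rw [← Matrix.det_one (n := Fin (Module.finrank ℂ W))]
    congr 1
    rw [add_eq_left]
    ext k l
    simp only [Matrix.of_apply, ContinuousLinearMap.comp_apply, sub_apply, one_apply_eq_self,
      inner_sub_right, map_sub, hbP, Matrix.zero_apply]
    ring
  have hup : HasFredholmDet (1 + P ∘L B ∘L (1 - P)) 1 := by
    have h := (hP.comp_right (B ∘L (1 - P))).hasFredholmDet
    rw [fredholmSeries_fintype] at h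
    convert h using 1
    symm
    rw [← Matrix.det_one (n := Fin (Module.finrank ℂ W))]
    congr 1
    rw [add_eq_left]
    ext k l
    simp [ContinuousLinearMap.adjoint_inner_left, hPb]
  have hmul := (hup.mul hcorner).mul hd
  have hmul' := hlow.mul hdQ
  have hop : ((1 + P ∘L B ∘L (1 - P)) ∘L (1 + (P ∘L B - 1) ∘L P)) ∘L (1 - K) =
      (1 + ((1 - P) ∘L (1 - K)) ∘L P) ∘L (1 - (1 - P) ∘L K ∘L (1 - P)) := by
    have h1 : ∀ z, B z - B (K z) = z := fun z => by
      have := congrArg (fun T : E →L[ℂ] E => T z) hBA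
      simpa using this
    ext z
    have h2 : P (B z) = P (B (K z)) + P z := by rw [← sub_eq_iff_eq_add', ← map_sub, h1]
    have h3 : ∀ z, P (B (P z)) = P (B (K (P z))) + P z := fun z => by
      rw [← sub_eq_iff_eq_add', ← map_sub, h1, hPP]
    simp only [ContinuousLinearMap.comp_apply, add_apply, sub_apply, one_apply_eq_self, map_sub,
      map_add, hPP, h2, h3]
    abel
  rw [hop] at hmul
  have := hmul.unique hmul'
  rw [eq_div_iff hd0]
  linear_combination this

end Jacobi

end

section

/-! ### Multiplication operators -/

/-- Normalised Haar measure on `ℝ/ℤ`. -/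
abbrev haar : Measure UnitAddCircle := AddCircle.haarAddCircle (T := (1 : ℝ))

lemma continuous_pt : Continuous pt := AddCircle.continuous_toCircle

lemma memLp_of_continuous {F : Type*} [NormedAddCommGroup F] {p : ℝ≥0∞} {g : UnitAddCircle → F}
    (hg : Continuous g) : MemLp g p haar := by
  obtain ⟨C, hC⟩ := isCompact_univ.exists_bound_of_continuousOn hg.continuousOn
  exact MemLp.of_bound (hg.aestronglyMeasurable_of_compactSpace) C
    (Eventually.of_forall fun x => hC x (Set.mem_univ x))

variable {m : ℕ}

lemma memLInf_of_continuous {a : Circle → Mat m} (ha : Continuous a) : MemLInf a := by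
  refine memLp_of_continuous ?_
  have h : Continuous fun A : Mat m => Matrix.toEuclideanCLM (n := Fin m) (𝕜 := ℂ) A :=
    LinearMap.continuous_of_finiteDimensional
      (Matrix.toEuclideanCLM (n := Fin m) (𝕜 := ℂ)).toAlgEquiv.toLinearMap
  exact h.comp (ha.comp continuous_pt)

lemma mulOp_ae {a : Circle → Mat m} (ha : Continuous a) (f : L2 m) :
    mulOp a f =ᵐ[haar] fun x => opSymbol a x (f x) := by
  rw [mulOp, dif_pos (memLInf_of_continuous ha), ContinuousLinearMap.holderL_apply_apply]
  refine (ContinuousLinearMap.coeFn_holder _ _ _).trans ?_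
  filter_upwards [MemLp.coeFn_toLp (memLInf_of_continuous ha)] with x hx
  rw [hx]; rfl

lemma mulOp_mul {a b : Circle → Mat m} (ha : Continuous a) (hb : Continuous b) :
    mulOp (fun t => a t * b t) = mulOp a ∘L mulOp b := by
  ext1 f
  refine Lp.ext ?_
  filter_upwards [mulOp_ae (a := fun t => a t * b t) (ha.mul hb) f, mulOp_ae ha (mulOp b f), mulOp_ae hb f]
    with x h1 h2 h3
  rw [h1, ContinuousLinearMap.comp_apply, h2, h3]
  simp only [opSymbol, map_mul]
  rfl

lemma mulOp_one : mulOp (fun _ => (1 : Mat m)) = 1 := by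
  ext1 f
  refine Lp.ext ?_
  filter_upwards [mulOp_ae (continuous_const (y := (1 : Mat m))) f] with x h1
  rw [h1]
  simp only [opSymbol, map_one]
  rfl

lemma adjoint_mulOp {a : Circle → Mat m} (ha : Continuous a) :
    ContinuousLinearMap.adjoint (mulOp a) = mulOp (fun t => (a t).conjTranspose) := by
  symm
  rw [ContinuousLinearMap.eq_adjoint_iff]
  intro f g
  rw [L2.inner_def, L2.inner_def]
  refine integral_congr_ae ?_
  filter_upwards [mulOp_ae ha.matrix_conjTranspose f, mulOp_ae ha g] with x h1 h2
  rw [h1, h2]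
  have : opSymbol (fun t => (a t).conjTranspose) x =
      ContinuousLinearMap.adjoint (opSymbol a x) := by
    rw [← ContinuousLinearMap.star_eq_adjoint, opSymbol, opSymbol, ← map_star]
    rfl
  rw [this, ContinuousLinearMap.adjoint_inner_left]

lemma inner_mulOp_left {a : Circle → Mat m} (ha : Continuous a) (f g : L2 m) :
    inner ℂ (mulOp a f) g = inner ℂ f (mulOp (fun t => (a t).conjTranspose) g) := by
  rw [← adjoint_mulOp ha, ContinuousLinearMap.adjoint_inner_right]

/-! ### Continuous functions as elements of `L²` -/

/-- The element `h · e_i` of `L²(𝕋; ℂᵐ)`, for a continuous function `h`. -/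
def contFn (h : C(Circle, ℂ)) (i : Fin m) : L2 m :=
  MemLp.toLp (fun x => h (pt x) • (EuclideanSpace.single i (1 : ℂ) : Vec m))
    (memLp_of_continuous ((h.continuous.comp continuous_pt).smul continuous_const))

lemma contFn_ae (h : C(Circle, ℂ)) (i : Fin m) :
    contFn h i =ᵐ[haar] fun x => h (pt x) • (EuclideanSpace.single i (1 : ℂ) : Vec m) :=
  MemLp.coeFn_toLp _

lemma inner_contFn (h : C(Circle, ℂ)) (i : Fin m) (f : L2 m) :
    inner ℂ (contFn h i) f = ∫ x, conj (h (pt x)) * (f x) i ∂haar := by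
  rw [L2.inner_def]
  refine integral_congr_ae ?_
  filter_upwards [contFn_ae h i] with x hx
  rw [hx, inner_smul_left, EuclideanSpace.inner_single_left, map_one, one_mul]

lemma inner_contFn_mulOp {a : Circle → Mat m} (ha : Continuous a) (h g : C(Circle, ℂ))
    (i j : Fin m) :
    inner ℂ (contFn h i) (mulOp a (contFn g j)) =
      ∫ x, conj (h (pt x)) * (a (pt x) i j * g (pt x)) ∂haar := by
  rw [inner_contFn]
  refine integral_congr_ae ?_
  filter_upwards [contFn_ae g j, mulOp_ae ha (contFn g j)] with x hx h1
  rw [h1, hx, map_smul]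
  congr 1
  rw [PiLp.smul_apply, opSymbol, Matrix.ofLp_toEuclideanCLM, smul_eq_mul, mul_comm]
  simp

lemma continuous_scalarSymbol (u : C(Circle, ℂ)) : Continuous (scalarSymbol m u) :=
  u.continuous.smul continuous_const

lemma opSymbol_scalarSymbol (u : Circle → ℂ) (x : UnitAddCircle) :
    opSymbol (scalarSymbol m u) x = u (pt x) • 1 := by
  rw [opSymbol, scalarSymbol, map_smul, map_one]

lemma mulOp_scalar_contFn (u h : C(Circle, ℂ)) (i : Fin m) :
    mulOp (scalarSymbol m u) (contFn h i) = contFn (u * h) i := by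
  refine Lp.ext ?_
  filter_upwards [contFn_ae h i, contFn_ae (u * h) i,
    mulOp_ae (continuous_scalarSymbol u) (contFn h i)] with x h1 h2 h3
  rw [h3, h2, h1, opSymbol_scalarSymbol, ContinuousMap.mul_apply, mul_smul]
  rfl

lemma contFn_add (h g : C(Circle, ℂ)) (i : Fin m) :
    contFn (h + g) i = contFn h i + contFn g i := by
  refine Lp.ext ?_
  filter_upwards [contFn_ae h i, contFn_ae g i, contFn_ae (h + g) i,
    Lp.coeFn_add (contFn h i) (contFn g i)] with x h1 h2 h3 h4
  rw [h4, h3, Pi.add_apply, h1, h2, ContinuousMap.add_apply, add_smul]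

lemma contFn_smul (c : ℂ) (h : C(Circle, ℂ)) (i : Fin m) :
    contFn (c • h) i = c • contFn h i := by
  refine Lp.ext ?_
  filter_upwards [contFn_ae h i, contFn_ae (c • h) i,
    Lp.coeFn_smul c (contFn h i)] with x h1 h3 h4
  rw [h4, h3, Pi.smul_apply, h1, ContinuousMap.smul_apply, smul_assoc]

/-! ### The Fourier basis -/

/-- The function `t ↦ t^n` on the circle. -/
def zpowFn (n : ℤ) : C(Circle, ℂ) :=
  ⟨fun t => ((t ^ n : Circle) : ℂ), continuous_induced_dom.comp (continuous_zpow n)⟩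

lemma zpowFn_apply (n : ℤ) (t : Circle) : zpowFn n t = (t : ℂ) ^ n := by
  simp [zpowFn]

lemma zpowFn_pt (n : ℤ) (x : UnitAddCircle) : zpowFn n (pt x) = fourier n x := by
  rw [fourier_apply, AddCircle.toCircle_zsmul]
  rfl

/-- The element `t^n e_i` of `L²`. -/
def mono (n : ℤ) (i : Fin m) : L2 m := contFn (zpowFn n) i

lemma integrable_L2 (f : L2 m) : Integrable f haar :=
  (Lp.memLp f).integrable (by norm_num)

lemma inner_mono (n : ℤ) (i : Fin m) (f : L2 m) :
    inner ℂ (mono n i) f = (fourierCoeff f n) i := by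
  rw [mono, inner_contFn, fourierCoeff]
  have h := ContinuousLinearMap.integral_comp_comm
    (EuclideanSpace.proj i : Vec m →L[ℂ] ℂ) ((integrable_L2 f).fourier_smul (-n))
  refine Eq.trans (integral_congr_ae (Eventually.of_forall fun x => ?_)) h
  simp only [zpowFn_pt, fourier_neg]
  rfl

lemma mem_H2_iff (f : L2 m) : f ∈ H2 m ↔ ∀ n : ℤ, n < 0 → ∀ i, inner ℂ (mono n i) f = 0 := by
  simp only [inner_mono]
  constructor
  · intro h n hn i
    have : fourierCoeff f n = 0 := h n hn
    rw [this]; rfl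
  · intro h n hn
    ext i
    exact h n hn i

lemma inner_mono_mulOp_mono {a : Circle → Mat m} (ha : Continuous a) (n k : ℤ) (i j : Fin m) :
    inner ℂ (mono n i) (mulOp a (mono k j)) = coeff a (n - k) i j := by
  rw [mono, mono, inner_contFn_mulOp ha, coeff, Matrix.of_apply, fourierCoeff]
  refine integral_congr_ae (Eventually.of_forall fun x => ?_)
  simp only [zpowFn_pt, smul_eq_mul]
  rw [← fourier_neg, neg_sub, sub_eq_add_neg, fourier_add]
  ring

lemma coeff_one (n : ℤ) : coeff (fun _ => (1 : Mat m)) n = if n = 0 then 1 else 0 := by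
  ext i j
  have h := fourierCoeff_fourier (T := (1 : ℝ)) 0
  have hc : (fun x : UnitAddCircle => (1 : Mat m) i j) =
      fun x => (1 : Mat m) i j * fourier 0 x := by
    funext x; simp
  rw [coeff, Matrix.of_apply, hc, fourierCoeff.const_mul, h]
  by_cases hn : n = 0 <;> simp [hn]

lemma orthonormal_mono : Orthonormal ℂ (fun p : ℤ × Fin m => mono (m := m) p.1 p.2) := by
  classical
  rw [orthonormal_iff_ite]
  rintro ⟨n, i⟩ ⟨k, j⟩
  have h := inner_mono_mulOp_mono (continuous_const (y := (1 : Mat m))) n k i j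
  rw [mulOp_one, one_apply_eq_self, coeff_one] at h
  rw [h]
  by_cases hn : n = k
  · simp [hn, Matrix.one_apply]
  · rw [if_neg (by omega), if_neg (by simp [hn])]; rfl

lemma eq_zero_of_fourierCoeff_eq_zero (f : L2 m) (hf : ∀ n, fourierCoeff f n = 0) : f = 0 := by
  have hi : ∀ i, (fun x => (f x) i) =ᵐ[haar] 0 := by
    intro i
    have hm : MemLp (fun x => (f x) i) 2 haar :=
      (EuclideanSpace.proj i : Vec m →L[ℂ] ℂ).comp_memLp' (Lp.memLp f)
    have h0 : hm.toLp _ = 0 := by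
      rw [← (fourierBasis (T := (1 : ℝ))).repr.map_eq_zero_iff]
      ext n
      rw [fourierBasis_repr, fourierCoeff_congr_ae hm.coeFn_toLp]
      have h1 := inner_mono n i f
      rw [hf n, mono, inner_contFn] at h1
      refine Eq.trans ?_ h1
      rw [fourierCoeff]
      refine integral_congr_ae (Eventually.of_forall fun x => ?_)
      simp only [zpowFn_pt, fourier_neg, smul_eq_mul]
    have h2 := hm.coeFn_toLp
    rw [h0] at h2
    exact h2.symm.trans (Lp.coeFn_zero _ _ _)
  refine (Lp.eq_zero_iff_ae_eq_zero).mpr ?_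
  filter_upwards [ae_all_iff.mpr hi] with x hx
  ext i
  exact hx i

lemma span_mono_orthogonal :
    (Submodule.span ℂ (Set.range fun p : ℤ × Fin m => mono (m := m) p.1 p.2))ᗮ = ⊥ := by
  rw [Submodule.eq_bot_iff]
  intro f hf
  refine eq_zero_of_fourierCoeff_eq_zero f fun n => ?_
  ext i
  rw [← inner_mono]
  exact (Submodule.mem_orthogonal _ _).mp hf _ (Submodule.subset_span ⟨(n, i), rfl⟩)

/-- The Hilbert basis `t^n e_i` of `L²`. -/
def monoBasis (m : ℕ) : HilbertBasis (ℤ × Fin m) ℂ (L2 m) :=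
  HilbertBasis.mkOfOrthogonalEqBot orthonormal_mono span_mono_orthogonal

lemma monoBasis_apply (p : ℤ × Fin m) : monoBasis m p = mono p.1 p.2 := by
  rw [monoBasis, HilbertBasis.coe_mkOfOrthogonalEqBot]

lemma ext_mono {f g : L2 m} (h : ∀ n i, inner ℂ (mono n i) f = inner ℂ (mono n i) g) : f = g := by
  rw [← sub_eq_zero]
  refine eq_zero_of_fourierCoeff_eq_zero _ fun n => ?_
  ext i
  rw [← inner_mono, inner_sub_right, h, sub_self]; rfl

lemma mono_mem_H2 {n : ℤ} (hn : 0 ≤ n) (i : Fin m) : mono n i ∈ H2 m := by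
  classical
  rw [mem_H2_iff]
  intro k hk j
  have := orthonormal_iff_ite.mp (orthonormal_mono (m := m)) (k, j) (n, i)
  rw [if_neg (by simp; omega)] at this
  exact this

lemma mem_H2_orthogonal_iff (f : L2 m) :
    f ∈ (H2 m)ᗮ ↔ ∀ n : ℤ, 0 ≤ n → ∀ i, inner ℂ (mono n i) f = 0 := by
  constructor
  · intro h n hn i
    exact (Submodule.mem_orthogonal _ _).mp h _ (mono_mem_H2 hn i)
  · intro h
    rw [Submodule.mem_orthogonal]
    intro g hg
    rw [← (monoBasis m).tsum_inner_mul_inner]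
    refine (tsum_congr fun p => ?_).trans tsum_zero
    rw [monoBasis_apply]
    rcases lt_or_ge p.1 0 with hp | hp
    · rw [← inner_conj_symm, (mem_H2_iff g).mp hg _ hp, map_zero, zero_mul]
    · rw [h _ hp, mul_zero]

/-! ### Analytic and coanalytic symbols -/

/-- Continuous matrix functions without Fourier coefficients of negative index. -/
structure IsPlus (a : Circle → Mat m) : Prop where
  continuous : Continuous a
  coeff_neg : ∀ n : ℤ, n < 0 → coeff a n = 0

/-- The adjoint of a plus function. -/
def IsMinus (a : Circle → Mat m) : Prop := IsPlus fun t => (a t).conjTranspose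

lemma IsPlus.conjTranspose {a : Circle → Mat m} (ha : IsPlus a) :
    IsMinus fun t => (a t).conjTranspose := by
  simpa only [IsMinus, Matrix.conjTranspose_conjTranspose] using ha

lemma IsMinus.continuous {a : Circle → Mat m} (ha : IsMinus a) : Continuous a := by
  simpa only [Matrix.conjTranspose_conjTranspose] using
    (IsPlus.continuous ha).matrix_conjTranspose

lemma IsPlus.mulOp_mem {a : Circle → Mat m} (ha : IsPlus a) {f : L2 m} (hf : f ∈ H2 m) :
    mulOp a f ∈ H2 m := by
  rw [mem_H2_iff]
  intro n hn i
  rw [← ContinuousLinearMap.adjoint_inner_left]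
  have h : ContinuousLinearMap.adjoint (mulOp a) (mono n i) ∈ (H2 m)ᗮ := by
    rw [mem_H2_orthogonal_iff]
    intro k hk j
    rw [ContinuousLinearMap.adjoint_inner_right, ← inner_conj_symm,
      inner_mono_mulOp_mono ha.continuous, ha.coeff_neg _ (by omega)]
    simp
  exact (Submodule.mem_orthogonal' _ _).mp h f hf

lemma IsMinus.mulOp_mem {a : Circle → Mat m} (ha : IsMinus a) {f : L2 m} (hf : f ∈ (H2 m)ᗮ) :
    mulOp a f ∈ (H2 m)ᗮ := by
  rw [Submodule.mem_orthogonal']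
  intro g hg
  rw [inner_mulOp_left ha.continuous]
  exact (Submodule.mem_orthogonal' _ _).mp hf _ (IsPlus.mulOp_mem ha hg)

end

section

variable {m : ℕ}

/-! ### The flip operator -/

lemma pt_neg (x : UnitAddCircle) : pt (-x) = (pt x)⁻¹ := AddCircle.toCircle_neg x

lemma ae_comp_neg {p : UnitAddCircle → Prop} (h : ∀ᵐ x ∂haar, p x) : ∀ᵐ x ∂haar, p (-x) :=
  measurePreserving_neg_circle.quasiMeasurePreserving.ae h

lemma flip_ae (f : L2 m) :
    flip m f =ᵐ[haar] fun x => (((pt x)⁻¹ : Circle) : ℂ) • f (-x) := by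
  have hc : Continuous (scalarSymbol m fun t => ((t⁻¹ : Circle) : ℂ)) :=
    continuous_scalarSymbol ⟨fun t => ((t⁻¹ : Circle) : ℂ), by fun_prop⟩
  have h1 := mulOp_ae hc (Lp.compMeasurePreserving (fun x : UnitAddCircle => -x)
    measurePreserving_neg_circle f)
  have h2 := Lp.coeFn_compMeasurePreserving f measurePreserving_neg_circle
  filter_upwards [h1, h2] with x h1 h2
  refine h1.trans ?_
  rw [h2, opSymbol_scalarSymbol]
  rfl

lemma conj_zpowFn (k : ℤ) (t : Circle) : conj (zpowFn k t) = (t : ℂ) ^ (-k) := by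
  rw [zpowFn_apply, map_zpow₀, ← Circle.coe_inv_eq_conj, Circle.coe_inv, inv_zpow, zpow_neg]

lemma inner_mono_flip (n : ℤ) (i : Fin m) (f : L2 m) :
    inner ℂ (mono n i) (flip m f) = inner ℂ (mono (-n - 1) i) f := by
  rw [mono, mono, inner_contFn, inner_contFn,
    ← (measurePreserving_neg_circle).integral_comp (MeasurableEquiv.neg _).measurableEmbedding
      (fun x => conj (zpowFn (-n - 1) (pt x)) * (f x) i)]
  refine integral_congr_ae ?_
  filter_upwards [flip_ae f] with x hx
  rw [hx, PiLp.smul_apply, smul_eq_mul, ← mul_assoc]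
  congr 1
  rw [pt_neg]
  have h0 : (pt x : ℂ) ≠ 0 := Circle.coe_ne_zero _
  rw [conj_zpowFn, conj_zpowFn, Circle.coe_inv, inv_zpow, ← zpow_neg, ← zpow_neg_one, ← zpow_add₀ h0]
  congr 1
  ring

lemma flip_flip (f : L2 m) : flip m (flip m f) = f := by
  refine ext_mono fun n i => ?_
  rw [inner_mono_flip, inner_mono_flip]
  congr 2
  ring

lemma flip_mem_orthogonal {f : L2 m} (hf : f ∈ H2 m) : flip m f ∈ (H2 m)ᗮ := by
  rw [mem_H2_orthogonal_iff]
  intro n hn i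
  rw [inner_mono_flip]
  exact (mem_H2_iff f).mp hf _ (by omega) i

lemma flip_mem {f : L2 m} (hf : f ∈ (H2 m)ᗮ) : flip m f ∈ H2 m := by
  rw [mem_H2_iff]
  intro n hn i
  rw [inner_mono_flip]
  exact (mem_H2_orthogonal_iff f).mp hf _ (by omega) i

lemma flip_mulOp {a : Circle → Mat m} (ha : Continuous a) (f : L2 m) :
    mulOp (tilde a) (flip m f) = flip m (mulOp a f) := by
  have hta : Continuous (tilde a) := ha.comp continuous_inv
  refine Lp.ext ?_
  filter_upwards [mulOp_ae hta (flip m f), flip_ae f, flip_ae (mulOp a f),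
    ae_comp_neg (mulOp_ae ha f)] with x h1 h2 h3 h4
  rw [h1, h2, h3, h4, map_smul]
  simp only [opSymbol, tilde, pt_neg]

lemma starProjection_flip (f : L2 m) :
    flip m ((H2 m).starProjection (flip m f)) = f - (H2 m).starProjection f := by
  have h1 : f = (H2 m).starProjection f + (f - (H2 m).starProjection f) := by abel
  have hm := Submodule.starProjection_apply_mem (H2 m) f
  have ho : f - (H2 m).starProjection f ∈ (H2 m)ᗮ := Submodule.sub_starProjection_mem_orthogonal f
  have h2 : (H2 m).starProjection (flip m f) = flip m (f - (H2 m).starProjection f) := by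
    conv_lhs => rw [h1]
    rw [map_add, map_add, (Submodule.starProjection_apply_eq_zero_iff _).mpr
      (flip_mem_orthogonal hm), zero_add,
      Submodule.starProjection_eq_self_iff.mpr (flip_mem ho)]
  rw [h2, flip_flip]

/-! ### Toeplitz and Hankel operators -/

lemma coe_proj (f : L2 m) : (proj m f : L2 m) = (H2 m).starProjection f := rfl

lemma proj_eq_zero {f : L2 m} (hf : f ∈ (H2 m)ᗮ) : proj m f = 0 := by
  apply Subtype.ext
  rw [coe_proj, (Submodule.starProjection_apply_eq_zero_iff _).mpr hf]; rfl

lemma coe_proj_of_mem {f : L2 m} (hf : f ∈ H2 m) : (proj m f : L2 m) = f :=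
  Submodule.starProjection_eq_self_iff.mpr hf

lemma inner_proj_right (g : H2 m) (f : L2 m) :
    inner ℂ g (proj m f) = inner ℂ (g : L2 m) f :=
  Submodule.inner_orthogonalProjectionOnto_eq_of_mem_left g f

lemma toeplitz_apply (a : Circle → Mat m) (f : H2 m) :
    toeplitz a f = proj m (mulOp a (f : L2 m)) := rfl

lemma toeplitz_one : toeplitz (fun _ => (1 : Mat m)) = 1 := by
  ext1 f
  apply Subtype.ext
  rw [toeplitz_apply, mulOp_one, one_apply_eq_self, coe_proj_of_mem f.2]; rfl

lemma toeplitz_mul_of_isPlus {a b : Circle → Mat m} (ha : Continuous a) (hb : IsPlus b) :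
    toeplitz (fun t => a t * b t) = toeplitz a ∘L toeplitz b := by
  ext1 f
  rw [ContinuousLinearMap.comp_apply, toeplitz_apply, toeplitz_apply, toeplitz_apply,
    coe_proj_of_mem (hb.mulOp_mem f.2), mulOp_mul ha hb.continuous]
  rfl

lemma proj_mulOp_starProjection {a : Circle → Mat m} (ha : IsMinus a) (f : L2 m) :
    proj m (mulOp a ((H2 m).starProjection f)) = proj m (mulOp a f) := by
  rw [← sub_eq_zero, ← map_sub, ← map_sub, ← neg_sub, map_neg, map_neg, neg_eq_zero]
  exact proj_eq_zero (ha.mulOp_mem (Submodule.sub_starProjection_mem_orthogonal f))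

lemma toeplitz_mul_of_isMinus {a b : Circle → Mat m} (ha : IsMinus a) (hb : Continuous b) :
    toeplitz (fun t => a t * b t) = toeplitz a ∘L toeplitz b := by
  ext1 f
  rw [ContinuousLinearMap.comp_apply, toeplitz_apply, toeplitz_apply, toeplitz_apply, coe_proj,
    proj_mulOp_starProjection ha, mulOp_mul ha.continuous hb]
  rfl

lemma inner_toeplitz_left {a : Circle → Mat m} (ha : Continuous a) (f g : H2 m) :
    inner ℂ (toeplitz a f) g = inner ℂ f (toeplitz (fun t => (a t).conjTranspose) g) := by
  rw [toeplitz_apply, toeplitz_apply, inner_proj_right, ← inner_mulOp_left ha,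
    ← inner_conj_symm (proj m _) g, inner_proj_right, inner_conj_symm]

/-- The operator `f ↦ P (a (I - P) (c f))` on `H²`. -/
def hankelProd (a c : Circle → Mat m) : H2 m →L[ℂ] H2 m :=
  proj m ∘L mulOp a ∘L (1 - (H2 m).starProjection) ∘L mulOp c ∘L (H2 m).subtypeL

lemma hankelProd_apply (a c : Circle → Mat m) (f : H2 m) :
    hankelProd a c f = proj m (mulOp a (mulOp c (f : L2 m) -
      (H2 m).starProjection (mulOp c (f : L2 m)))) := rfl

lemma hankel_apply (a : Circle → Mat m) (f : H2 m) :
    hankel a f = proj m (mulOp a (flip m (f : L2 m))) := by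
  have h : hankel a f = proj m (mulOp a (flip m (f : L2 m) -
    (H2 m).starProjection (flip m (f : L2 m)))) := rfl
  rw [h, (Submodule.starProjection_apply_eq_zero_iff _).mpr (flip_mem_orthogonal f.2), sub_zero]

lemma hankel_comp_hankel_tilde {b c : Circle → Mat m} (hc : Continuous c) :
    hankel b ∘L hankel (tilde c) = hankelProd b c := by
  ext1 f
  rw [ContinuousLinearMap.comp_apply, hankelProd_apply, hankel_apply, hankel_apply,
    flip_mulOp hc, coe_proj, starProjection_flip]

lemma toeplitz_mul {b c : Circle → Mat m} (hb : Continuous b) (hc : Continuous c) :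
    toeplitz (fun t => b t * c t) = toeplitz b ∘L toeplitz c + hankelProd b c := by
  ext1 f
  rw [add_apply, hankelProd_apply, ContinuousLinearMap.comp_apply, toeplitz_apply, toeplitz_apply,
    toeplitz_apply, coe_proj, ← map_add, ← map_add, add_sub_cancel, mulOp_mul hb hc]
  rfl

lemma hankelProd_factor {v a c w : Circle → Mat m} (hv : IsMinus v) (ha : Continuous a)
    (hc : Continuous c) (hw : IsPlus w) :
    hankelProd (fun t => v t * a t) (fun t => c t * w t) =
      toeplitz v ∘L hankelProd a c ∘L toeplitz w := by
  ext1 f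
  simp only [ContinuousLinearMap.comp_apply, hankelProd_apply, toeplitz_apply, coe_proj]
  rw [Submodule.starProjection_eq_self_iff.mpr (hw.mulOp_mem f.2), proj_mulOp_starProjection hv,
    mulOp_mul hv.continuous ha, mulOp_mul hc hw.continuous]
  rfl

/-! ### Trace class property -/

lemma hasSum_sub_starProjection (f : L2 m) :
    HasSum (fun p : ℕ × Fin m => inner ℂ (mono (-(p.1 : ℤ) - 1) p.2) f •
      mono (-(p.1 : ℤ) - 1) p.2) (f - (H2 m).starProjection f) := by
  have h := (monoBasis m).hasSum_repr (f - (H2 m).starProjection f)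
  simp only [HilbertBasis.repr_apply_apply, monoBasis_apply] at h
  let φ : ℕ × Fin m → ℤ × Fin m := fun p => (-(p.1 : ℤ) - 1, p.2)
  have hφ : Function.Injective φ := by
    rintro ⟨k, i⟩ ⟨l, j⟩ hkl
    simp only [φ, Prod.mk.injEq] at hkl
    ext
    · simp; omega
    · simp [hkl.2]
  rw [← hφ.hasSum_iff] at h
  · convert h using 2 with p
    simp only [φ, Function.comp_apply, inner_sub_right]
    have h0 : inner ℂ (mono (m := m) (-(p.1 : ℤ) - 1) p.2) ((H2 m).starProjection f) = 0 :=
      (mem_H2_iff _).mp (Submodule.starProjection_apply_mem (H2 m) f) _ (by omega) _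
    rw [h0, sub_zero]
  · rintro ⟨n, i⟩ hn
    have hn0 : 0 ≤ n := by
      by_contra hneg
      refine hn ⟨((-n - 1).toNat, i), ?_⟩
      simp only [φ, Prod.mk.injEq, and_true]
      omega
    rw [(mem_H2_orthogonal_iff _).mp (Submodule.sub_starProjection_mem_orthogonal f) n hn0 i,
      zero_smul]

lemma hasSum_norm_sq_proj (f : L2 m) :
    HasSum (fun p : ℕ × Fin m => ‖inner ℂ (mono (p.1 : ℤ) p.2) f‖ ^ 2) (‖proj m f‖ ^ 2) := by
  have h := (monoBasis m).hasSum_inner_mul_inner ((H2 m).starProjection f)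
    ((H2 m).starProjection f)
  simp only [monoBasis_apply] at h
  let φ : ℕ × Fin m → ℤ × Fin m := fun p => ((p.1 : ℤ), p.2)
  have hφ : Function.Injective φ := by
    rintro ⟨k, i⟩ ⟨l, j⟩ hkl
    simp only [φ, Prod.mk.injEq] at hkl
    ext
    · simp; omega
    · simp [hkl.2]
  rw [← hφ.hasSum_iff, inner_self_eq_norm_sq_to_K] at h
  · rw [← Complex.hasSum_ofReal]
    have hterm : (fun p : ℕ × Fin m =>
        ((‖inner ℂ (mono (m := m) (p.1 : ℤ) p.2) f‖ ^ 2 : ℝ) : ℂ)) =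
        (fun p : ℤ × Fin m => inner ℂ ((H2 m).starProjection f) (mono p.1 p.2) *
          inner ℂ (mono p.1 p.2) ((H2 m).starProjection f)) ∘ φ := by
      funext p
      simp only [φ, Function.comp_apply]
      have h0 : inner ℂ (mono (m := m) (p.1 : ℤ) p.2) ((H2 m).starProjection f) =
          inner ℂ (mono (p.1 : ℤ) p.2) f := by
        rw [← Submodule.inner_starProjection_left_eq_right, Submodule.starProjection_eq_self_iff.mpr
          (mono_mem_H2 (by positivity) _)]
      rw [h0, ← inner_conj_symm _ (mono (m := m) (p.1 : ℤ) p.2), h0, Complex.conj_mul']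
      push_cast; rfl
    have hval : ((‖proj m f‖ ^ 2 : ℝ) : ℂ) = (‖(H2 m).starProjection f‖ : ℂ) ^ 2 := by
      push_cast; rfl
    rw [hterm, hval]
    exact h
  · rintro ⟨n, i⟩ hn
    have hn0 : n < 0 := by
      by_contra hneg
      refine hn ⟨(n.toNat, i), ?_⟩
      simp only [φ, Prod.mk.injEq, and_true]
      omega
    rw [(mem_H2_iff _).mp (Submodule.starProjection_apply_mem (H2 m) f) n hn0 i, mul_zero]

lemma summable_add_of_summable_mul {g : ℕ → ℝ} (hg : ∀ n, 0 ≤ g n)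
    (h : Summable fun n : ℕ => ((n : ℝ) + 1) * g n) :
    Summable fun p : ℕ × ℕ => g (p.1 + p.2) := by
  rw [← (Finset.HasAntidiagonal.sigmaAntidiagonalEquivProd (A := ℕ)).summable_iff,
    summable_sigma_of_nonneg (fun _ => by rw [Function.comp_apply]; exact hg _)]
  refine ⟨fun n => (hasSum_fintype _).summable, ?_⟩
  refine h.congr fun n => ?_
  rw [tsum_fintype]
  have : ∀ q : Finset.HasAntidiagonal.antidiagonal n,
      ((fun p : ℕ × ℕ => g (p.1 + p.2)) ∘ Finset.HasAntidiagonal.sigmaAntidiagonalEquivProd) ⟨n, q⟩ = g n := by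
    intro q
    have := Finset.HasAntidiagonal.mem_antidiagonal.mp q.2
    simp only [Function.comp_apply, Finset.HasAntidiagonal.sigmaAntidiagonalEquivProd_apply, this]
  rw [Finset.sum_congr rfl fun q _ => this q]
  simp

/-- The Krein condition on the Fourier coefficients with positive index. -/
def KreinPlus (a : Circle → Mat m) : Prop :=
  ∀ i j, Summable fun n : ℕ => ((n : ℝ) + 1) * ‖coeff a ((n : ℤ) + 1) i j‖ ^ 2

lemma KreinPlus.summable_norm_sq {a : Circle → Mat m} (hc : Continuous a) (ha : KreinPlus a) :
    Summable fun p : ℕ × Fin m => ‖proj m (mulOp a (mono (-(p.1 : ℤ) - 1) p.2))‖ ^ 2 := by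
  have h1 : ∀ i j, Summable fun q : ℕ × ℕ => ‖coeff a (((q.1 + q.2 : ℕ) : ℤ) + 1) j i‖ ^ 2 :=
    fun i j => summable_add_of_summable_mul (g := fun n => ‖coeff a ((n : ℤ) + 1) j i‖ ^ 2)
      (fun n => by positivity) (ha j i)
  have hterm : ∀ (p q : ℕ × Fin m),
      ‖inner ℂ (mono (q.1 : ℤ) q.2) (mulOp a (mono (-(p.1 : ℤ) - 1) p.2))‖ ^ 2 =
        ‖coeff a (((p.1 + q.1 : ℕ) : ℤ) + 1) q.2 p.2‖ ^ 2 := by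
    intro p q
    rw [inner_mono_mulOp_mono hc]
    congr 4
    push_cast; ring
  have h2 : Summable fun r : (Fin m × Fin m) × (ℕ × ℕ) =>
      ‖coeff a (((r.2.1 + r.2.2 : ℕ) : ℤ) + 1) r.1.2 r.1.1‖ ^ 2 := by
    rw [summable_prod_of_nonneg (fun _ => by positivity)]
    exact ⟨fun ij => h1 ij.1 ij.2, (hasSum_fintype _).summable⟩
  let e : (ℕ × Fin m) × (ℕ × Fin m) ≃ (Fin m × Fin m) × (ℕ × ℕ) :=
    (Equiv.prodProdProdComm ℕ (Fin m) ℕ (Fin m)).trans (Equiv.prodComm _ _)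
  have h3 := e.summable_iff.mpr h2
  rw [summable_prod_of_nonneg (fun _ => by rw [Function.comp_apply]; exact sq_nonneg _)] at h3
  refine h3.2.congr fun p => ?_
  rw [← (hasSum_norm_sq_proj _).tsum_eq]
  exact tsum_congr fun q => (hterm p q).symm

lemma isTraceClass_hankelProd {a c : Circle → Mat m} (ha : Continuous a) (hc : Continuous c)
    (hka : KreinPlus a) (hkc : KreinPlus fun t => (c t).conjTranspose) :
    IsTraceClass (hankelProd a c) := by
  have hrep : IsNuclearRep
      (fun p : ℕ × Fin m => proj m (mulOp (fun t => (c t).conjTranspose)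
        (mono (-(p.1 : ℤ) - 1) p.2)))
      (fun p => proj m (mulOp a (mono (-(p.1 : ℤ) - 1) p.2))) (hankelProd a c) := by
    constructor
    · refine Summable.of_nonneg_of_le (fun p => by positivity) (fun p => ?_)
        ((hkc.summable_norm_sq hc.matrix_conjTranspose).add (hka.summable_norm_sq ha))
      nlinarith [sq_nonneg (‖proj m (mulOp (fun t => (c t).conjTranspose)
        (mono (-(p.1 : ℤ) - 1) p.2))‖ - ‖proj m (mulOp a (mono (-(p.1 : ℤ) - 1) p.2))‖),
        sq_nonneg (‖proj m (mulOp (fun t => (c t).conjTranspose)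
        (mono (-(p.1 : ℤ) - 1) p.2))‖), sq_nonneg ‖proj m (mulOp a (mono (-(p.1 : ℤ) - 1) p.2))‖]
    · intro f
      have h := (proj m ∘L mulOp a).hasSum (hasSum_sub_starProjection (mulOp c (f : L2 m)))
      have hterm : (fun p : ℕ × Fin m => inner ℂ (proj m (mulOp (fun t => (c t).conjTranspose)
          (mono (-(p.1 : ℤ) - 1) p.2))) f • proj m (mulOp a (mono (-(p.1 : ℤ) - 1) p.2))) =
          fun p => (proj m ∘L mulOp a) (inner ℂ (mono (-(p.1 : ℤ) - 1) p.2) (mulOp c (f : L2 m)) •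
            mono (-(p.1 : ℤ) - 1) p.2) := by
        funext p
        rw [map_smul, ← inner_conj_symm _ f, inner_proj_right, inner_conj_symm,
          inner_mulOp_left hc.matrix_conjTranspose]
        simp only [Matrix.conjTranspose_conjTranspose]
        rfl
      rw [hterm]
      exact h
  exact hrep.isTraceClass

end

section

variable {m : ℕ}

/-! ### Wiener–Hopf factors -/

lemma coeff_transpose (a : Circle → Mat m) (n : ℤ) :
    coeff (fun t => (a t).transpose) n = (coeff a n).transpose := rfl

lemma IsPlus.transpose {a : Circle → Mat m} (ha : IsPlus a) : IsPlus fun t => (a t).transpose :=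
  ⟨ha.continuous.matrix_transpose, fun n hn => by
    rw [coeff_transpose, ha.coeff_neg n hn, Matrix.transpose_zero]⟩

lemma KreinPlus.transpose {a : Circle → Mat m} (ha : KreinPlus a) :
    KreinPlus fun t => (a t).transpose :=
  fun i j => ha j i

/-- The entries have absolutely convergent Fourier series. -/
def IsWiener (a : Circle → Mat m) : Prop := ∀ i j, Summable fun n : ℤ => ‖coeff a n i j‖

open scoped Matrix.Norms.Elementwise in
lemma MemWK.isWiener {a : Circle → Mat m} (ha : MemWK a) : IsWiener a :=
  fun _ _ => Summable.of_nonneg_of_le (fun _ => norm_nonneg _)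
    (fun n => Matrix.norm_entry_le_entrywise_sup_norm (coeff a n)) ha.2.1

open scoped Matrix.Norms.Elementwise in
lemma MemWK.kreinPlus {a : Circle → Mat m} (ha : MemWK a) : KreinPlus a := by
  intro i j
  have hinj : Function.Injective fun n : ℕ => (n : ℤ) + 1 := fun k l h => by simpa using h
  refine Summable.of_nonneg_of_le (fun _ => by positivity) (fun n => ?_)
    (ha.2.2.comp_injective hinj)
  have h1 : |(((n : ℤ) + 1 : ℤ) : ℝ)| = (n : ℝ) + 1 := by
    push_cast; exact abs_of_nonneg (by positivity)
  rw [Function.comp_apply, h1]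
  gcongr
  exact Matrix.norm_entry_le_entrywise_sup_norm (coeff a ((n : ℤ) + 1))

lemma IsPlusFactor.isPlus {w : Circle → Mat m} (hw : IsPlusFactor w) : IsPlus w :=
  ⟨hw.memWK.1, hw.memHInf.2⟩

lemma IsPlusFactor.inv_isPlus {w : Circle → Mat m} (hw : IsPlusFactor w) :
    IsPlus fun t => (w t)⁻¹ :=
  ⟨hw.inv_memWK.1, hw.inv_memHInf.2⟩

lemma conjTranspose_eq_transpose_conjSymbol (w : Circle → Mat m) (t : Circle) :
    (w t).conjTranspose = (conjSymbol w t).transpose := rfl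

lemma conjTranspose_inv_eq (w : Circle → Mat m) (t : Circle) :
    ((w t)⁻¹).conjTranspose = (invSymbol (conjSymbol w) t).transpose := by
  rw [Matrix.conjTranspose_nonsing_inv, invSymbol, Matrix.transpose_nonsing_inv]
  rfl

lemma IsMinusFactor.isUnit {w : Circle → Mat m} (hw : IsMinusFactor w) (t : Circle) :
    IsUnit (w t) := by
  have h := IsPlusFactor.isUnit hw t
  rw [Matrix.isUnit_iff_isUnit_det] at h ⊢
  rw [← Matrix.det_transpose, ← conjTranspose_eq_transpose_conjSymbol,
    Matrix.det_conjTranspose] at h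
  exact isUnit_star.mp h

lemma IsMinusFactor.isMinus {w : Circle → Mat m} (hw : IsMinusFactor w) : IsMinus w :=
  (IsPlusFactor.isPlus hw).transpose

lemma IsMinusFactor.inv_isMinus {w : Circle → Mat m} (hw : IsMinusFactor w) :
    IsMinus fun t => (w t)⁻¹ := by
  rw [IsMinus]
  simp only [conjTranspose_inv_eq]
  exact (IsPlusFactor.inv_isPlus hw).transpose

/-- The operator identities behind the determinant formula: `I - H(b) H(c̃)` has a two-sided
inverse `B`, and `T(a) = T(v₊) B T(v₋)`. -/
theorem exists_inverse_one_sub_hankel {a wm wp vp vm b c : Circle → Mat m}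
    (hwm : IsMinusFactor wm) (hwp : IsPlusFactor wp)
    (hvp : IsPlusFactor vp) (hvm : IsMinusFactor vm)
    (haw : ∀ t, a t = wm t * wp t) (hav : ∀ t, a t = vp t * vm t)
    (hb : ∀ t, b t = vm t * (wp t)⁻¹) (hc : ∀ t, c t = (wm t)⁻¹ * vp t) :
    IsTraceClass (hankel b ∘L hankel (tilde c)) ∧
    ∃ B : H2 m →L[ℂ] H2 m, (1 - hankel b ∘L hankel (tilde c)) ∘L B = 1 ∧
      B ∘L (1 - hankel b ∘L hankel (tilde c)) = 1 ∧
      toeplitz a = toeplitz vp ∘L B ∘L toeplitz vm := by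
  obtain rfl : b = fun t => vm t * (wp t)⁻¹ := funext hb
  obtain rfl : c = fun t => (wm t)⁻¹ * vp t := funext hc
  obtain rfl : a = fun t => wm t * wp t := funext haw
  have cvm := hvm.isMinus.continuous
  have cwmi := hwm.inv_isMinus.continuous
  have cwm := hwm.isMinus.continuous
  have cvmi := hvm.inv_isMinus.continuous
  have cwpi := hwp.inv_isPlus.continuous
  have cvp := hvp.isPlus.continuous
  have cvpi := hvp.inv_isPlus.continuous
  have cb : Continuous fun t => vm t * (wp t)⁻¹ := cvm.mul cwpi
  have cc : Continuous fun t => (wm t)⁻¹ * vp t := cwmi.mul cvp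
  have hdet : ∀ {w : Circle → Mat m}, (∀ t, IsUnit (w t)) → ∀ t, IsUnit (w t).det :=
    fun h t => (Matrix.isUnit_iff_isUnit_det _).mp (h t)
  have inv_mul : ∀ {w : Circle → Mat m}, (∀ t, IsUnit (w t)) →
      (fun t => (w t)⁻¹ * w t) = fun _ => 1 :=
    fun h => funext fun t => Matrix.nonsing_inv_mul _ (hdet h t)
  have mul_inv : ∀ {w : Circle → Mat m}, (∀ t, IsUnit (w t)) →
      (fun t => w t * (w t)⁻¹) = fun _ => 1 :=
    fun h => funext fun t => Matrix.mul_nonsing_inv _ (hdet h t)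
  rw [hankel_comp_hankel_tilde cc]
  have hbc : (fun t => (vm t * (wp t)⁻¹) * ((wm t)⁻¹ * vp t)) = fun _ => (1 : Mat m) := by
    funext t
    have h1 : (wp t)⁻¹ * (wm t)⁻¹ = (vm t)⁻¹ * (vp t)⁻¹ := by
      rw [← Matrix.mul_inv_rev, ← Matrix.mul_inv_rev, ← hav t]
    calc (vm t * (wp t)⁻¹) * ((wm t)⁻¹ * vp t)
        = vm t * ((wp t)⁻¹ * (wm t)⁻¹) * vp t := by simp only [mul_assoc]
      _ = (vm t * (vm t)⁻¹) * ((vp t)⁻¹ * vp t) := by rw [h1]; simp only [mul_assoc]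
      _ = 1 := by
        rw [Matrix.mul_nonsing_inv _ (hdet hvm.isUnit t),
          Matrix.nonsing_inv_mul _ (hdet hvp.isUnit t), one_mul]
  have hA : 1 - hankelProd (fun t => vm t * (wp t)⁻¹) (fun t => (wm t)⁻¹ * vp t) =
      (toeplitz vm * toeplitz fun t => (wp t)⁻¹) *
        ((toeplitz fun t => (wm t)⁻¹) * toeplitz vp) := by
    have h := toeplitz_mul cb cc
    rw [hbc, toeplitz_one, toeplitz_mul_of_isMinus hvm.isMinus cwpi,
      toeplitz_mul_of_isPlus cwmi hvp.isPlus] at h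
    rw [h, add_sub_cancel_right]; rfl
  have hTa : toeplitz (fun t => wm t * wp t) = toeplitz wm * toeplitz wp :=
    toeplitz_mul_of_isPlus cwm hwp.isPlus
  have p1 : toeplitz vp * (toeplitz fun t => (vp t)⁻¹) = 1 :=
    (toeplitz_mul_of_isPlus cvp hvp.inv_isPlus).symm.trans
      (by rw [mul_inv hvp.isUnit, toeplitz_one])
  have p2 : (toeplitz fun t => (vp t)⁻¹) * toeplitz vp = 1 :=
    (toeplitz_mul_of_isPlus cvpi hvp.isPlus).symm.trans
      (by rw [inv_mul hvp.isUnit, toeplitz_one])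
  have q1 : toeplitz wp * (toeplitz fun t => (wp t)⁻¹) = 1 :=
    (toeplitz_mul_of_isPlus hwp.isPlus.continuous hwp.inv_isPlus).symm.trans
      (by rw [mul_inv hwp.isUnit, toeplitz_one])
  have q2 : (toeplitz fun t => (wp t)⁻¹) * toeplitz wp = 1 :=
    (toeplitz_mul_of_isPlus cwpi hwp.isPlus).symm.trans
      (by rw [inv_mul hwp.isUnit, toeplitz_one])
  have r1 : toeplitz vm * (toeplitz fun t => (vm t)⁻¹) = 1 :=
    (toeplitz_mul_of_isMinus hvm.isMinus cvmi).symm.trans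
      (by rw [mul_inv hvm.isUnit, toeplitz_one])
  have r2 : (toeplitz fun t => (vm t)⁻¹) * toeplitz vm = 1 :=
    (toeplitz_mul_of_isMinus hvm.inv_isMinus cvm).symm.trans
      (by rw [inv_mul hvm.isUnit, toeplitz_one])
  have s1 : toeplitz wm * (toeplitz fun t => (wm t)⁻¹) = 1 :=
    (toeplitz_mul_of_isMinus hwm.isMinus cwmi).symm.trans
      (by rw [mul_inv hwm.isUnit, toeplitz_one])
  have s2 : (toeplitz fun t => (wm t)⁻¹) * toeplitz wm = 1 :=
    (toeplitz_mul_of_isMinus hwm.inv_isMinus cwm).symm.trans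
      (by rw [inv_mul hwm.isUnit, toeplitz_one])
  refine ⟨?_, (toeplitz fun t => (vp t)⁻¹) * (toeplitz wm * toeplitz wp) *
    (toeplitz fun t => (vm t)⁻¹), ?_, ?_, ?_⟩
  · rw [hankelProd_factor hvm.isMinus cwpi cwmi hvp.isPlus]
    refine ((isTraceClass_hankelProd cwpi cwmi hwp.inv_memWK.kreinPlus ?_).comp_right _).comp_left _
    simp only [conjTranspose_inv_eq]
    exact (IsPlusFactor.inv_memWK hwm).kreinPlus.transpose
  · rw [hA, ← ContinuousLinearMap.mul_def]
    generalize toeplitz vm = x1 at *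
    generalize (toeplitz fun t => (vm t)⁻¹) = x2 at *
    generalize toeplitz vp = x3 at *
    generalize (toeplitz fun t => (vp t)⁻¹) = x4 at *
    generalize toeplitz wm = x5 at *
    generalize (toeplitz fun t => (wm t)⁻¹) = x6 at *
    generalize toeplitz wp = x7 at *
    generalize (toeplitz fun t => (wp t)⁻¹) = x8 at *
    calc x1 * x8 * (x6 * x3) * (x4 * (x5 * x7) * x2)
        = x1 * (x8 * ((x6 * ((x3 * x4) * x5)) * x7)) * x2 := by simp only [mul_assoc]
      _ = 1 := by rw [p1, one_mul, s2, one_mul, q2, mul_one, r1]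
  · rw [hA, ← ContinuousLinearMap.mul_def]
    generalize toeplitz vm = x1 at *
    generalize (toeplitz fun t => (vm t)⁻¹) = x2 at *
    generalize toeplitz vp = x3 at *
    generalize (toeplitz fun t => (vp t)⁻¹) = x4 at *
    generalize toeplitz wm = x5 at *
    generalize (toeplitz fun t => (wm t)⁻¹) = x6 at *
    generalize toeplitz wp = x7 at *
    generalize (toeplitz fun t => (wp t)⁻¹) = x8 at *
    calc x4 * (x5 * x7) * x2 * (x1 * x8 * (x6 * x3))
        = x4 * (x5 * ((x7 * ((x2 * x1) * x8)) * x6)) * x3 := by simp only [mul_assoc]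
      _ = 1 := by rw [r2, one_mul, q1, one_mul, s1, mul_one, p2]
  · rw [hTa, ← ContinuousLinearMap.mul_def, ← ContinuousLinearMap.mul_def]
    generalize toeplitz wm * toeplitz wp = y
    calc y = (toeplitz vp * (toeplitz fun t => (vp t)⁻¹)) * y *
          ((toeplitz fun t => (vm t)⁻¹) * toeplitz vm) := by rw [p1, r2, one_mul, mul_one]
      _ = _ := by simp only [mul_assoc]

end

section

variable {m : ℕ}

/-! ### Functions of the disc algebra -/

/-- Functions continuous on the closed unit disc and holomorphic in the open unit disc. -/
abbrev IsDisc (F : ℂ → ℂ) : Prop := DiffContOnCl ℂ F (Metric.ball 0 1)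

lemma closure_unitBall : closure (Metric.ball (0 : ℂ) 1) = Metric.closedBall 0 1 :=
  closure_ball 0 one_ne_zero

lemma IsDisc.fun_mul {F G : ℂ → ℂ} (hF : IsDisc F) (hG : IsDisc G) :
    IsDisc fun z => F z * G z := hF.smul hG

lemma IsDisc.fun_sum {ι : Type*} (s : Finset ι) {F : ι → ℂ → ℂ} (hF : ∀ i ∈ s, IsDisc (F i)) :
    IsDisc fun z => ∑ i ∈ s, F i z :=
  ⟨DifferentiableOn.fun_sum fun i hi => (hF i hi).1, continuousOn_finsetSum s fun i hi => (hF i hi).2⟩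

lemma IsDisc.fun_prod {ι : Type*} (s : Finset ι) {F : ι → ℂ → ℂ} (hF : ∀ i ∈ s, IsDisc (F i)) :
    IsDisc fun z => ∏ i ∈ s, F i z :=
  ⟨DifferentiableOn.fun_finsetProd fun i hi => (hF i hi).1,
    continuousOn_finsetProd s fun i hi => (hF i hi).2⟩

lemma IsDisc.det {V : ℂ → Mat m} (hV : ∀ i j, IsDisc fun z => V z i j) :
    IsDisc fun z => (V z).det := by
  simp only [Matrix.det_apply']
  exact IsDisc.fun_sum _ fun σ _ =>
    IsDisc.fun_mul diffContOnCl_const (IsDisc.fun_prod Finset.univ fun i _ => hV (σ i) i)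

lemma coe_circle_mem_closedBall (t : Circle) : (t : ℂ) ∈ Metric.closedBall (0 : ℂ) 1 := by
  rw [mem_closedBall_zero_iff, Circle.norm_coe]

lemma IsDisc.continuous_circle {F : ℂ → ℂ} (hF : IsDisc F) :
    Continuous fun t : Circle => F t :=
  hF.continuousOn_ball.comp_continuous (by fun_prop) coe_circle_mem_closedBall

lemma IsDisc.eqOn {F G : ℂ → ℂ} (hF : IsDisc F) (hG : IsDisc G)
    (h : ∀ t : Circle, F t = G t) {z : ℂ} (hz : z ∈ Metric.closedBall (0 : ℂ) 1) :
    F z = G z := by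
  rw [← closure_unitBall] at hz
  refine Complex.eqOn_closure_of_eqOn_frontier Metric.isBounded_ball hF hG ?_ hz
  intro w hw
  rw [frontier_ball 0 one_ne_zero, mem_sphere_zero_iff_norm] at hw
  exact h ⟨w, mem_sphere_zero_iff_norm.mpr hw⟩

lemma circle_exp_eq_circleMap (θ : ℝ) : ((Circle.exp θ : Circle) : ℂ) = circleMap 0 1 θ := by
  simp [circleMap, Circle.coe_exp]

lemma integral_haar_eq_circleAverage (F : ℂ → ℂ) :
    ∫ x, F (pt x) ∂haar = Real.circleAverage F 0 1 := by
  rw [AddCircle.integral_haarAddCircle, inv_one, one_smul,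
    ← UnitAddCircle.intervalIntegral_preimage 0, Real.circleAverage_def]
  have h : ∀ x : ℝ, F (pt (x : UnitAddCircle)) = F (circleMap 0 1 (x * (2 * Real.pi))) := by
    intro x
    rw [← circle_exp_eq_circleMap, pt, AddCircle.toCircle_apply_mk]
    congr 3
    ring
  simp_rw [h]
  rw [intervalIntegral.integral_comp_mul_right (fun θ => F (circleMap 0 1 θ)) (by positivity)]
  simp

/-- The Szegő kernel `k_α(z) = 1 / (1 - ᾱ z)`. -/
def szego (α z : ℂ) : ℂ := (1 - conj α * z)⁻¹

lemma one_sub_conj_mul_ne_zero (α : 𝔻) {z : ℂ} (hz : z ∈ Metric.closedBall (0 : ℂ) 1) :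
    1 - conj (α : ℂ) * z ≠ 0 := by
  intro h
  have h1 : conj (α : ℂ) * z = 1 := (sub_eq_zero.mp h).symm
  have h2 := congrArg norm h1
  rw [norm_mul, RCLike.norm_conj, norm_one] at h2
  have h3 : ‖z‖ ≤ 1 := by simpa using hz
  have h4 := α.norm_lt_one
  nlinarith [norm_nonneg (α : ℂ), norm_nonneg z]

lemma isDisc_szego (α : 𝔻) : IsDisc (szego (α : ℂ)) :=
  DifferentiableOn.diffContOnCl (by
    rw [closure_unitBall]
    intro z hz
    have := one_sub_conj_mul_ne_zero α hz
    unfold szego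
    exact DifferentiableAt.differentiableWithinAt (DifferentiableAt.fun_inv (by fun_prop) this))

lemma isDisc_moebius (α : 𝔻) : IsDisc (moebius (α : ℂ)) :=
  DifferentiableOn.diffContOnCl (by
    rw [closure_unitBall]
    intro z hz
    have := one_sub_conj_mul_ne_zero α hz
    unfold moebius
    exact DifferentiableAt.differentiableWithinAt (DifferentiableAt.fun_div (by fun_prop) (by fun_prop) this))

/-- Cauchy's formula: the Szegő kernel reproduces the values of disc functions. -/
lemma integral_conj_szego_mul {F : ℂ → ℂ} (hF : IsDisc F) (α : 𝔻) :
    ∫ x, conj (szego (α : ℂ) (pt x)) * F (pt x) ∂haar = F (α : ℂ) := by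
  rw [← DiffContOnCl.circleAverage_smul_div (R := 1) (c := 0) (w := (α : ℂ)) (f := F)
    (by simpa using hF) (by simpa using α.norm_lt_one), ← integral_haar_eq_circleAverage]
  refine integral_congr_ae (Eventually.of_forall fun x => ?_)
  have h0 : (pt x : ℂ) ≠ 0 := Circle.coe_ne_zero _
  simp only [szego, map_inv₀, map_sub, map_one, map_mul, Complex.conj_conj,
    ← Circle.coe_inv_eq_conj, Circle.coe_inv, sub_zero, smul_eq_mul]
  congr 1
  rw [← one_div, ← mul_inv_cancel₀ h0, ← sub_mul, mul_inv_cancel₀ h0, div_mul_eq_div_div_swap]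
  simp

lemma norm_moebius_lt_one (α : 𝔻) {z : ℂ} (hz : ‖z‖ < 1) : ‖moebius (α : ℂ) z‖ < 1 := by
  have hne := one_sub_conj_mul_ne_zero α (z := z) (by simpa using hz.le)
  rw [moebius, norm_div, div_lt_one (norm_pos_iff.mpr hne)]
  refine lt_of_pow_lt_pow_left₀ 2 (norm_nonneg _) ?_
  rw [← Complex.normSq_eq_norm_sq, ← Complex.normSq_eq_norm_sq]
  have key : Complex.normSq (1 - conj (α : ℂ) * z) - Complex.normSq (z - α) =
      (1 - Complex.normSq z) * (1 - Complex.normSq (α : ℂ)) := by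
    simp only [Complex.normSq_apply, Complex.sub_re, Complex.sub_im, Complex.mul_re,
      Complex.mul_im, Complex.conj_re, Complex.conj_im, Complex.one_re, Complex.one_im]
    ring
  have h1 : 0 < 1 - Complex.normSq z := by
    rw [Complex.normSq_eq_norm_sq]; nlinarith [norm_nonneg z]
  have h2 : 0 < 1 - Complex.normSq (α : ℂ) := by
    rw [Complex.normSq_eq_norm_sq]; nlinarith [norm_nonneg (α : ℂ), α.norm_lt_one]
  nlinarith [mul_pos h1 h2]

lemma IsDisc.comp_moebius {F : ℂ → ℂ} (hF : IsDisc F) (α : 𝔻) :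
    IsDisc fun z => F (moebius (α : ℂ) z) :=
  DiffContOnCl.comp hF (isDisc_moebius α) fun z hz => by
    simpa using norm_moebius_lt_one α (by simpa using hz)

/-! ### Logarithms -/

lemma exists_log_unitBall {F : ℂ → ℂ} (hF : IsDisc F)
    (h0 : ∀ z ∈ Metric.closedBall (0 : ℂ) 1, F z ≠ 0) :
    ∃ L : ℂ → ℂ, DifferentiableOn ℂ L (Metric.ball 0 1) ∧
      ∀ z ∈ Metric.ball (0 : ℂ) 1, Complex.exp (L z) = F z := by
  have h0' : ∀ z ∈ Metric.ball (0 : ℂ) 1, F z ≠ 0 :=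
    fun z hz => h0 z (Metric.ball_subset_closedBall hz)
  have hd : DifferentiableOn ℂ (fun z => deriv F z / F z) (Metric.ball 0 1) :=
    (hF.1.deriv Metric.isOpen_ball).div hF.1 h0'
  obtain ⟨G, hG0, hG⟩ := hd.isExactOn_ball.with_val_at 0 (Complex.log (F 0))
  refine ⟨G, fun z hz => (hG z hz).differentiableAt.differentiableWithinAt, fun z hz => ?_⟩
  have hder : ∀ w ∈ Metric.ball (0 : ℂ) 1,
      HasDerivAt (fun z => Complex.exp (-G z) * F z) 0 w := by
    intro w hw
    have hFw : HasDerivAt F (deriv F w) w :=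
      (hF.1.differentiableAt (Metric.isOpen_ball.mem_nhds hw)).hasDerivAt
    have h1 := div_mul_cancel₀ (deriv F w) (h0' w hw)
    refine (((hG w hw).fun_neg.cexp).fun_mul hFw).congr_deriv ?_
    linear_combination -Complex.exp (-G w) * h1
  have hconst := Metric.isOpen_ball.is_const_of_deriv_eq_zero
    (convex_ball (0 : ℂ) 1).isPreconnected
    (fun w hw => (hder w hw).differentiableAt.differentiableWithinAt)
    (fun w hw => (hder w hw).deriv) hz (Metric.mem_ball_self one_pos)
  have h00 := h0' 0 (Metric.mem_ball_self one_pos)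
  simp only [hG0, Complex.exp_neg, Complex.exp_log h00, inv_mul_cancel₀ h00] at hconst
  rw [inv_mul_eq_iff_eq_mul₀ (Complex.exp_ne_zero _), mul_one] at hconst
  exact hconst.symm

/-- A zero-free disc function has a logarithm that is a disc function. -/
lemma exists_isDisc_log {F : ℂ → ℂ} (hF : IsDisc F)
    (h0 : ∀ z ∈ Metric.closedBall (0 : ℂ) 1, F z ≠ 0) :
    ∃ L : ℂ → ℂ, IsDisc L ∧ ∀ z ∈ Metric.closedBall (0 : ℂ) 1, Complex.exp (L z) = F z := by
  obtain ⟨L, hL, hexp⟩ := exists_log_unitBall hF h0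
  have hcomp : IsCompact (Metric.closedBall (0 : ℂ) 1) := isCompact_closedBall 0 1
  obtain ⟨z₀, hz₀, hmin⟩ := hcomp.exists_isMinOn ⟨0, by simp⟩ hF.continuousOn_ball.norm
  have hδ : 0 < ‖F z₀‖ := norm_pos_iff.mpr (h0 z₀ hz₀)
  have huc := hcomp.uniformContinuousOn_of_continuous hF.continuousOn_ball
  rw [Metric.uniformContinuousOn_iff] at huc
  obtain ⟨ε, hε, huc⟩ := huc _ hδ
  obtain ⟨r, hr1, hr2⟩ : ∃ r : ℝ, max 0 (1 - ε) < r ∧ r < 1 :=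
    exists_between (max_lt one_pos (by linarith))
  have hr0 : 0 < r := (le_max_left _ _).trans_lt hr1
  have hrε : 1 - ε < r := (le_max_right _ _).trans_lt hr1
  have hmap : ∀ z ∈ Metric.closedBall (0 : ℂ) 1, (r : ℂ) * z ∈ Metric.ball (0 : ℂ) 1 := by
    intro z hz
    have hz' : ‖z‖ ≤ 1 := by simpa using hz
    rw [mem_ball_zero_iff, norm_mul, Complex.norm_real, Real.norm_of_nonneg hr0.le]
    nlinarith
  have hslit : ∀ z ∈ Metric.closedBall (0 : ℂ) 1, F z / F (r * z) ∈ Complex.slitPlane := by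
    intro z hz
    have hz' : ‖z‖ ≤ 1 := by simpa using hz
    have hrz := Metric.ball_subset_closedBall (hmap z hz)
    have hd : dist z (r * z) < ε := by
      rw [dist_eq_norm, show z - r * z = ((1 - r : ℝ) : ℂ) * z by push_cast; ring, norm_mul,
        Complex.norm_real, Real.norm_of_nonneg (by linarith)]
      nlinarith [norm_nonneg z]
    have h1 := huc z hz _ hrz hd
    have h2 : ‖F z₀‖ ≤ ‖F (r * z)‖ := hmin hrz
    have h3 : ‖F z / F (r * z) - 1‖ < 1 := by
      rw [div_sub_one (h0 _ hrz), norm_div, div_lt_one (norm_pos_iff.mpr (h0 _ hrz)),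
        ← dist_eq_norm]
      linarith
    have h4 := Complex.abs_re_le_norm (F z / F (r * z) - 1)
    refine Or.inl ?_
    rw [Complex.sub_re, Complex.one_re] at h4
    linarith [(abs_lt.mp (h4.trans_lt h3)).1]
  have hball : ∀ z ∈ Metric.ball (0 : ℂ) 1, z ∈ Metric.closedBall (0 : ℂ) 1 :=
    fun z hz => Metric.ball_subset_closedBall hz
  have hlin : Differentiable ℂ fun z : ℂ => (r : ℂ) * z := by fun_prop
  refine ⟨fun z => L (r * z) + Complex.log (F z / F (r * z)), DiffContOnCl.mk_ball ?_ ?_, ?_⟩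
  · refine DifferentiableOn.add (hL.comp hlin.differentiableOn fun z hz => hmap z (hball z hz)) ?_
    refine DifferentiableOn.clog (hF.1.div
      (hF.1.comp hlin.differentiableOn fun z hz => hmap z (hball z hz)) fun z hz =>
        h0 _ (hball _ (hmap z (hball z hz)))) fun z hz => hslit z (hball z hz)
  · refine ContinuousOn.add (hL.continuousOn.comp hlin.continuous.continuousOn hmap) ?_
    refine ContinuousOn.clog (hF.continuousOn_ball.div
      (hF.1.continuousOn.comp hlin.continuous.continuousOn hmap) fun z hz =>
        h0 _ (hball _ (hmap z hz))) hslit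
  · intro z hz
    have hrz := h0 _ (hball _ (hmap z hz))
    rw [Complex.exp_add, hexp _ (hmap z hz), Complex.exp_log (div_ne_zero (h0 z hz) hrz),
      mul_div_cancel₀ _ hrz]

/-! ### The analytic extension of a plus function -/

/-- The extension `∑ a_n z^n` of a plus function to the unit disc. -/
def discExt (a : Circle → Mat m) (z : ℂ) : Mat m :=
  Matrix.of fun i j => ∑' n : ℕ, coeff a (n : ℤ) i j * z ^ n

lemma isDisc_discExt {a : Circle → Mat m} (hw : IsWiener a) (i j : Fin m) :
    IsDisc fun z => discExt a z i j := by
  have hs : Summable fun n : ℕ => ‖coeff a (n : ℤ) i j‖ :=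
    (hw i j).comp_injective Nat.cast_injective
  have hle : ∀ (n : ℕ) (z : ℂ), ‖z‖ ≤ 1 →
      ‖coeff a (n : ℤ) i j * z ^ n‖ ≤ ‖coeff a (n : ℤ) i j‖ := by
    intro n z hz
    rw [norm_mul, norm_pow]
    exact mul_le_of_le_one_right (norm_nonneg _) (pow_le_one₀ (norm_nonneg _) hz)
  refine DiffContOnCl.mk_ball ?_ ?_
  · exact Complex.differentiableOn_tsum_of_summable_norm hs (fun n => by fun_prop) Metric.isOpen_ball
      fun n z hz => hle n z (le_of_lt (by simpa using hz))
  · exact continuousOn_tsum (fun n => by fun_prop) hs fun n z hz => hle n z (by simpa using hz)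

lemma pt_surjective : Function.Surjective pt := by
  intro t
  refine ⟨(AddCircle.homeomorphCircle (T := 1) one_ne_zero).symm t, ?_⟩
  rw [pt, ← AddCircle.homeomorphCircle_apply one_ne_zero, Homeomorph.apply_symm_apply]

lemma discExt_circle {a : Circle → Mat m} (ha : IsPlus a) (hw : IsWiener a) (t : Circle) :
    discExt a (t : ℂ) = a t := by
  obtain ⟨x, rfl⟩ := pt_surjective t
  ext i j
  let f : C(UnitAddCircle, ℂ) :=
    ⟨fun x => a (pt x) i j, (ha.continuous.matrix_elem i j).comp continuous_pt⟩
  have h := has_pointwise_sum_fourier_series_of_summable (f := f) (Summable.of_norm (hw i j)) x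
  rw [← (Nat.cast_injective (R := ℤ)).hasSum_iff] at h
  · rw [discExt, Matrix.of_apply]
    refine Eq.trans (tsum_congr fun n => ?_) h.tsum_eq
    rw [Function.comp_apply, ← zpowFn_pt, zpowFn_apply, zpow_natCast, smul_eq_mul]
    rfl
  · intro n hn
    have hn0 : n < 0 := by
      by_contra hneg
      exact hn ⟨n.toNat, by simp; omega⟩
    have h1 : fourierCoeff f n = coeff a n i j := rfl
    rw [h1, ha.coeff_neg n hn0]; simp

lemma IsPlusFactor.det_discExt_ne_zero {w : Circle → Mat m} (hw : IsPlusFactor w) {z : ℂ}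
    (hz : z ∈ Metric.closedBall (0 : ℂ) 1) : (discExt w z).det ≠ 0 := by
  have h1 := IsDisc.det (isDisc_discExt hw.memWK.isWiener)
  have h2 := IsDisc.det (isDisc_discExt hw.inv_memWK.isWiener)
  have h := (h1.fun_mul h2).eqOn (diffContOnCl_const (c := (1 : ℂ))) (fun t => by
    rw [discExt_circle hw.isPlus hw.memWK.isWiener,
      discExt_circle (a := invSymbol w) hw.inv_isPlus hw.inv_memWK.isWiener, invSymbol, ← Matrix.det_mul,
      Matrix.mul_nonsing_inv _ ((Matrix.isUnit_iff_isUnit_det _).mp (hw.isUnit t)),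
      Matrix.det_one]) hz
  exact left_ne_zero_of_mul_eq_one h

/-! ### Geometric means -/

lemma continuous_moebiusCircle (α : 𝔻) : Continuous (moebiusCircle α) :=
  Continuous.subtype_mk (isDisc_moebius α).continuous_circle _

lemma integral_log_comp_moebius {L : ℂ → ℂ} (hL : IsDisc L) (α : 𝔻) :
    (1 / (2 * (Real.pi : ℂ))) *
      ∫ θ in (0 : ℝ)..(2 * Real.pi), L (moebiusCircle (-α) (Circle.exp θ)) = L α := by
  have h := DiffContOnCl.circleAverage (R := 1) (c := 0)
    (f := fun z => L (moebius ((-α : 𝔻) : ℂ) z)) (by simpa using hL.comp_moebius (-α))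
  rw [Real.circleAverage_def] at h
  have h0 : moebius ((-α : 𝔻) : ℂ) 0 = α := by simp [moebius]
  rw [h0] at h
  rw [← h, Complex.real_smul]
  simp_rw [← circle_exp_eq_circleMap]
  push_cast
  rw [one_div]
  rfl

theorem isGeometricMean_comp_moebius {a vp vm : Circle → Mat m} (hvp : IsPlusFactor vp)
    (hvm : IsMinusFactor vm) (hav : ∀ t, a t = vp t * vm t) (α : 𝔻) :
    IsGeometricMean (a ∘ moebiusCircle (-α))
      ((discExt vp α).det * conj (discExt (conjSymbol vm) α).det) := by
  obtain ⟨L₁, hL₁, hexp₁⟩ := exists_isDisc_log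
    (IsDisc.det (isDisc_discExt hvp.memWK.isWiener)) fun z hz => hvp.det_discExt_ne_zero hz
  obtain ⟨L₂, hL₂, hexp₂⟩ := exists_isDisc_log
    (IsDisc.det (isDisc_discExt (IsPlusFactor.memWK hvm).isWiener))
    fun z hz => IsPlusFactor.det_discExt_ne_zero hvm hz
  have hα : (α : ℂ) ∈ Metric.closedBall (0 : ℂ) 1 := by simpa using α.norm_lt_one.le
  have c₁ : Continuous fun t : Circle => L₁ (moebiusCircle (-α) t) :=
    hL₁.continuous_circle.comp (continuous_moebiusCircle _)
  have c₂ : Continuous fun t : Circle => L₂ (moebiusCircle (-α) t) :=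
    hL₂.continuous_circle.comp (continuous_moebiusCircle _)
  refine ⟨fun t => L₁ (moebiusCircle (-α) t) + conj (L₂ (moebiusCircle (-α) t)),
    c₁.add (Complex.continuous_conj.comp c₂), fun t => ?_, ?_⟩
  · rw [Complex.exp_add, Complex.exp_conj, hexp₁ _ (coe_circle_mem_closedBall _),
      hexp₂ _ (coe_circle_mem_closedBall _), discExt_circle hvp.isPlus hvp.memWK.isWiener,
      discExt_circle (IsPlusFactor.isPlus hvm) (IsPlusFactor.memWK hvm).isWiener,
      Function.comp_apply, hav, Matrix.det_mul]
    congr 1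
    rw [← Matrix.det_transpose, ← conjTranspose_eq_transpose_conjSymbol, Matrix.det_conjTranspose,
      Complex.star_def, Complex.conj_conj]
  · have ce : Continuous fun θ : ℝ => Circle.exp θ := Circle.exp.continuous
    have hsum := intervalIntegral.integral_add (μ := volume)
      ((c₁.comp ce).intervalIntegrable 0 (2 * Real.pi))
      (((Complex.continuous_conj.comp c₂).comp ce).intervalIntegrable 0 (2 * Real.pi))
    simp only [Function.comp_apply] at hsum
    rw [hsum, mul_add, integral_log_comp_moebius hL₁, Complex.exp_add, hexp₁ _ hα]
    congr 1
    have hconj : ∫ θ in (0 : ℝ)..(2 * Real.pi), conj (L₂ (moebiusCircle (-α) (Circle.exp θ))) =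
        conj (∫ θ in (0 : ℝ)..(2 * Real.pi), L₂ (moebiusCircle (-α) (Circle.exp θ))) := by
      rw [intervalIntegral.integral_of_le Real.two_pi_pos.le,
        intervalIntegral.integral_of_le Real.two_pi_pos.le, integral_conj]
    have h2 := congrArg conj (integral_log_comp_moebius hL₂ α)
    rw [map_mul, ← hconj] at h2
    have h3 : conj (1 / (2 * (Real.pi : ℂ))) = 1 / (2 * (Real.pi : ℂ)) := by
      rw [map_div₀, map_mul, map_one, Complex.conj_ofReal, map_ofNat]
    rw [h3] at h2
    rw [h2, Complex.exp_conj, hexp₂ _ hα]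

end

section

variable {m : ℕ}

/-! ### Multiplication by scalar functions -/

/-- The boundary function of a disc function. -/
def discFn (F : ℂ → ℂ) (hF : IsDisc F) : C(Circle, ℂ) := ⟨fun t => F t, hF.continuous_circle⟩

lemma discFn_apply {F : ℂ → ℂ} (hF : IsDisc F) (t : Circle) : discFn F hF t = F t := rfl

lemma mulOp_scalar_mul (u v : C(Circle, ℂ)) :
    mulOp (scalarSymbol m (u * v : C(Circle, ℂ))) =
      mulOp (scalarSymbol m u) ∘L mulOp (scalarSymbol m v) := by
  rw [← mulOp_mul (continuous_scalarSymbol u) (continuous_scalarSymbol v)]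
  congr 1
  funext t
  simp only [scalarSymbol, ContinuousMap.mul_apply]
  rw [smul_mul_smul_comm, one_mul]

lemma mulOp_scalar_one : mulOp (scalarSymbol m (1 : C(Circle, ℂ))) = 1 := by
  rw [← mulOp_one]
  congr 1
  funext t
  simp [scalarSymbol]

lemma inner_mulOp_scalar_left (u : C(Circle, ℂ)) (f g : L2 m) :
    inner ℂ (mulOp (scalarSymbol m u) f) g =
      inner ℂ f (mulOp (scalarSymbol m (star u : C(Circle, ℂ))) g) := by
  rw [inner_mulOp_left (continuous_scalarSymbol u)]
  congr 3
  funext t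
  simp [scalarSymbol, Matrix.conjTranspose_smul]

lemma mulOp_scalar_comm {a : Circle → Mat m} (ha : Continuous a) (u : C(Circle, ℂ)) (f : L2 m) :
    mulOp a (mulOp (scalarSymbol m u) f) = mulOp (scalarSymbol m u) (mulOp a f) := by
  have h1 := mulOp_mul ha (continuous_scalarSymbol u)
  have h2 := mulOp_mul (continuous_scalarSymbol u) ha
  have h3 : (fun t => a t * scalarSymbol m u t) = fun t => scalarSymbol m u t * a t := by
    funext t
    simp [scalarSymbol]
  rw [h3, h2] at h1
  exact (congrArg (fun T : L2 m →L[ℂ] L2 m => T f) h1).symm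

lemma inner_contFn_contFn (h g : C(Circle, ℂ)) (i j : Fin m) :
    inner ℂ (contFn h i) (contFn g j) =
      ∫ x, conj (h (pt x)) * ((1 : Mat m) i j * g (pt x)) ∂haar := by
  rw [← inner_contFn_mulOp (continuous_const (y := (1 : Mat m))), mulOp_one, one_apply_eq_self]

lemma contFn_discFn_mem_H2 {F : ℂ → ℂ} (hF : IsDisc F) (i : Fin m) :
    contFn (discFn F hF) i ∈ H2 m := by
  rw [mem_H2_iff]
  intro n hn j
  obtain ⟨k, rfl⟩ : ∃ k : ℕ, n = -((k : ℤ) + 1) := ⟨(-n - 1).toNat, by omega⟩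
  rw [mono, inner_contFn_contFn]
  have hd : IsDisc fun z => (1 : Mat m) j i * (z ^ (k + 1) * F z) :=
    IsDisc.fun_mul diffContOnCl_const
      (IsDisc.fun_mul (differentiable_pow (k + 1)).diffContOnCl hF)
  have h := DiffContOnCl.circleAverage (R := 1) (c := 0) (by simpa using hd)
  rw [← integral_haar_eq_circleAverage] at h
  refine Eq.trans (integral_congr_ae (Eventually.of_forall fun x => ?_)) (h.trans (by simp))
  simp only [conj_zpowFn, discFn_apply, neg_neg]
  have : (pt x : ℂ) ^ ((k : ℤ) + 1) = (pt x : ℂ) ^ (k + 1) := by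
    rw [← zpow_natCast]; push_cast; rfl
  rw [this]
  ring

/-! ### Blaschke factors -/

lemma blaschkeFactor_eq (α : ℂ) :
    ∃ c : ℂ, ‖c‖ = 1 ∧ ∀ z, blaschkeFactor α z = c * moebius α z := by
  by_cases h : α = 0
  · exact ⟨1, norm_one, fun z => by simp [blaschkeFactor, h, moebius]⟩
  · refine ⟨-conj α / (‖α‖ : ℂ), ?_, fun z => by rw [blaschkeFactor, if_neg h]⟩
    rw [norm_div, norm_neg, RCLike.norm_conj, Complex.norm_real, norm_norm,
      div_self (norm_ne_zero_iff.mpr h)]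

lemma isDisc_blaschkeFactor (α : 𝔻) : IsDisc (blaschkeFactor (α : ℂ)) := by
  obtain ⟨c, -, h⟩ := blaschkeFactor_eq (α : ℂ)
  rw [funext h]
  exact IsDisc.fun_mul diffContOnCl_const (isDisc_moebius α)

lemma norm_blaschkeFactor (α : 𝔻) (t : Circle) : ‖blaschkeFactor (α : ℂ) (t : ℂ)‖ = 1 := by
  obtain ⟨c, hc, h⟩ := blaschkeFactor_eq (α : ℂ)
  rw [h, norm_mul, hc, norm_moebius, one_mul]

lemma blaschkeFactor_self (α : ℂ) : blaschkeFactor α α = 0 := by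
  obtain ⟨c, -, h⟩ := blaschkeFactor_eq α
  rw [h, moebius, sub_self, zero_div, mul_zero]

/-- A function of `H²` that is orthogonal to the Szegő kernels at `α` is divisible by `μ_α`. -/
lemma mulOp_star_moebius_mem_H2 (α : 𝔻) {g : L2 m} (hg : g ∈ H2 m)
    (h : ∀ i, inner ℂ (contFn (discFn _ (isDisc_szego α)) i) g = 0) :
    mulOp (scalarSymbol m (star (discFn _ (isDisc_moebius α)) : C(Circle, ℂ))) g ∈ H2 m := by
  set μ := discFn _ (isDisc_moebius α) with hμ
  have hmono : ∀ (k : ℕ) (i : Fin m), inner ℂ (contFn (zpowFn (-((k : ℤ) + 1))) i) g = 0 :=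
    fun k i => (mem_H2_iff g).mp hg _ (by omega) i
  have key : ∀ (k : ℕ) (i : Fin m), inner ℂ (contFn (μ * zpowFn (-((k : ℤ) + 1))) i) g = 0 := by
    intro k i
    induction k with
    | zero =>
      have hdec : μ * zpowFn (-(((0 : ℕ) : ℤ) + 1)) =
          (1 - (α : ℂ) * conj (α : ℂ)) • discFn _ (isDisc_szego α) +
            (-(α : ℂ)) • zpowFn (-(((0 : ℕ) : ℤ) + 1)) := by
        ext t
        have h1 := one_sub_conj_mul_ne_zero α (coe_circle_mem_closedBall t)
        have h0 : (t : ℂ) ≠ 0 := Circle.coe_ne_zero t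
        simp only [hμ, ContinuousMap.mul_apply, ContinuousMap.add_apply, ContinuousMap.smul_apply,
          discFn_apply, zpowFn_apply, moebius, szego, smul_eq_mul, Nat.cast_zero, zero_add,
          zpow_neg, zpow_one]
        generalize hd : 1 - conj (α : ℂ) * t = d at h1 ⊢
        field_simp
        rw [← hd]
        ring
      rw [hdec, contFn_add, contFn_smul, contFn_smul, inner_add_left, inner_smul_left,
        inner_smul_left, h, hmono, mul_zero, mul_zero, add_zero]
    | succ k ih =>
      have hdec : μ * zpowFn (-(((k + 1 : ℕ) : ℤ) + 1)) =
          (conj (α : ℂ)) • (μ * zpowFn (-((k : ℤ) + 1))) + (zpowFn (-((k : ℤ) + 1)) +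
            (-(α : ℂ)) • zpowFn (-(((k + 1 : ℕ) : ℤ) + 1))) := by
        ext t
        have h1 := one_sub_conj_mul_ne_zero α (coe_circle_mem_closedBall t)
        have h0 : (t : ℂ) ≠ 0 := Circle.coe_ne_zero t
        have h2 : (t : ℂ) ^ (-((k : ℤ) + 1)) = t * (t : ℂ) ^ (-(((k + 1 : ℕ) : ℤ) + 1)) := by
          rw [← zpow_one_add₀ h0]
          congr 1
        simp only [hμ, ContinuousMap.mul_apply, ContinuousMap.add_apply, ContinuousMap.smul_apply,
          discFn_apply, zpowFn_apply, moebius, smul_eq_mul, h2]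
        generalize (t : ℂ) ^ (-(((k + 1 : ℕ) : ℤ) + 1)) = s
        generalize hd : 1 - conj (α : ℂ) * t = d at h1 ⊢
        field_simp
        rw [← hd]
        ring
      rw [hdec, contFn_add, contFn_add, contFn_smul, contFn_smul, inner_add_left, inner_add_left,
        inner_smul_left, inner_smul_left, ih, hmono, hmono, mul_zero, mul_zero, add_zero, add_zero]
  rw [mem_H2_iff]
  intro n hn i
  obtain ⟨k, rfl⟩ : ∃ k : ℕ, n = -((k : ℤ) + 1) := ⟨(-n - 1).toNat, by omega⟩
  rw [← inner_mulOp_scalar_left, mono, mulOp_scalar_contFn]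
  exact key k i

lemma mulOp_star_blaschkeFactor_mem_H2 (α : 𝔻) {g : L2 m} (hg : g ∈ H2 m)
    (h : ∀ i, inner ℂ (contFn (discFn _ (isDisc_szego α)) i) g = 0) :
    mulOp (scalarSymbol m (star (discFn _ (isDisc_blaschkeFactor α)) : C(Circle, ℂ))) g ∈
      H2 m := by
  obtain ⟨c, -, hc⟩ := blaschkeFactor_eq (α : ℂ)
  have h1 : scalarSymbol m (star (discFn _ (isDisc_blaschkeFactor α)) : C(Circle, ℂ)) =
      fun t => (conj c • (1 : Mat m)) *
        scalarSymbol m (star (discFn _ (isDisc_moebius α)) : C(Circle, ℂ)) t := by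
    funext t
    simp only [scalarSymbol, ContinuousMap.star_apply, discFn_apply, hc, Complex.star_def,
      map_mul]
    rw [smul_mul_smul_comm, one_mul]
  have h2 : mulOp (fun _ : Circle => conj c • (1 : Mat m)) = conj c • 1 := by
    ext1 f
    refine Lp.ext ?_
    filter_upwards [mulOp_ae (continuous_const (y := conj c • (1 : Mat m))) f,
      Lp.coeFn_smul (conj c) f] with x hx hx'
    rw [hx, smul_apply, one_apply_eq_self, hx', opSymbol, map_smul, map_one]
    rfl
  rw [h1, mulOp_mul continuous_const (continuous_scalarSymbol _), h2]
  exact (H2 m).smul_mem _ (mulOp_star_moebius_mem_H2 α hg h)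

/-! ### The Takenaka–Malmquist basis of the model space -/

variable {N : ℕ} (α : Fin N → 𝔻)

/-- The product of the Blaschke factors with index in `s`. -/
def partialBlaschke (s : Finset (Fin N)) (z : ℂ) : ℂ := ∏ l ∈ s, blaschkeFactor (α l : ℂ) z

lemma isDisc_partialBlaschke (s : Finset (Fin N)) : IsDisc (partialBlaschke α s) :=
  IsDisc.fun_prod s fun l _ => isDisc_blaschkeFactor (α l)

lemma conj_partialBlaschke_mul (s : Finset (Fin N)) (t : Circle) :
    conj (partialBlaschke α s t) * partialBlaschke α s t = 1 := by
  rw [Complex.conj_mul', partialBlaschke, norm_prod,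
    Finset.prod_congr rfl fun l _ => norm_blaschkeFactor (α l) t]
  simp

lemma partialBlaschke_eq_zero {s : Finset (Fin N)} {j : Fin N} (hj : j ∈ s) :
    partialBlaschke α s (α j : ℂ) = 0 :=
  Finset.prod_eq_zero hj (blaschkeFactor_self _)

/-- The Takenaka–Malmquist functions. -/
def tmFun (j : Fin N) (z : ℂ) : ℂ :=
  (Real.sqrt (1 - ‖(α j : ℂ)‖ ^ 2) : ℂ) * (partialBlaschke α (Finset.Iio j) z * szego (α j) z)

lemma isDisc_tmFun (j : Fin N) : IsDisc (tmFun α j) :=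
  IsDisc.fun_mul diffContOnCl_const
    (IsDisc.fun_mul (isDisc_partialBlaschke α _) (isDisc_szego (α j)))

/-- The Takenaka–Malmquist vectors in `L²`. -/
def tmVec (p : Fin N × Fin m) : L2 m := contFn (discFn _ (isDisc_tmFun α p.1)) p.2

lemma integral_conj_tmFun_mul (j : Fin N) {s : Finset (Fin N)} (hs : Finset.Iio j ⊆ s)
    {F : ℂ → ℂ} (hF : IsDisc F) :
    ∫ x, conj (tmFun α j (pt x)) * (partialBlaschke α s (pt x) * F (pt x)) ∂haar =
      (Real.sqrt (1 - ‖(α j : ℂ)‖ ^ 2) : ℂ) *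
        (partialBlaschke α (s \ Finset.Iio j) (α j) * F (α j)) := by
  have hd : IsDisc fun z => (Real.sqrt (1 - ‖(α j : ℂ)‖ ^ 2) : ℂ) *
      (partialBlaschke α (s \ Finset.Iio j) z * F z) :=
    IsDisc.fun_mul diffContOnCl_const (IsDisc.fun_mul (isDisc_partialBlaschke α _) hF)
  rw [← integral_conj_szego_mul hd (α j)]
  refine integral_congr_ae (Eventually.of_forall fun x => ?_)
  have hsplit : partialBlaschke α s (pt x) =
      partialBlaschke α (s \ Finset.Iio j) (pt x) * partialBlaschke α (Finset.Iio j) (pt x) :=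
    (Finset.prod_sdiff hs).symm
  have h1 := conj_partialBlaschke_mul α (Finset.Iio j) (pt x)
  simp only [tmFun, map_mul, Complex.conj_ofReal]
  rw [hsplit]
  linear_combination (Real.sqrt (1 - ‖(α j : ℂ)‖ ^ 2) : ℂ) * conj (szego (α j : ℂ) (pt x)) *
    partialBlaschke α (s \ Finset.Iio j) (pt x) * F (pt x) * h1

lemma one_sub_norm_sq_pos (β : 𝔻) : 0 < 1 - ‖(β : ℂ)‖ ^ 2 := by
  nlinarith [norm_nonneg (β : ℂ), β.norm_lt_one]

lemma inner_tmVec_mulOp {v : Circle → Mat m} (hv : Continuous v) {V : ℂ → Mat m}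
    (hV : ∀ i j, IsDisc fun z => V z i j) (hVv : ∀ t : Circle, V t = v t)
    {j l : Fin N} (hjl : j ≤ l) (i p : Fin m) :
    inner ℂ (tmVec α (j, i)) (mulOp v (tmVec α (l, p))) = if j = l then V (α j) i p else 0 := by
  rw [tmVec, tmVec, inner_contFn_mulOp hv]
  have hF : IsDisc fun z => (Real.sqrt (1 - ‖(α l : ℂ)‖ ^ 2) : ℂ) * (V z i p * szego (α l) z) :=
    IsDisc.fun_mul diffContOnCl_const (IsDisc.fun_mul (hV i p) (isDisc_szego (α l)))
  have h := integral_conj_tmFun_mul α j (s := Finset.Iio l)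
    (Finset.Iio_subset_Iio hjl) hF
  refine Eq.trans (integral_congr_ae (Eventually.of_forall fun x => ?_)) (h.trans ?_)
  · simp only [discFn_apply, tmFun, ← hVv]
    ring
  · by_cases hjl' : j = l
    · subst hjl'
      rw [if_pos rfl, sdiff_self, Finset.bot_eq_empty, partialBlaschke, Finset.prod_empty, szego,
        Complex.conj_mul', one_mul]
      have hpos := one_sub_norm_sq_pos (α j)
      have hs : (Real.sqrt (1 - ‖(α j : ℂ)‖ ^ 2) : ℂ) * (Real.sqrt (1 - ‖(α j : ℂ)‖ ^ 2) : ℂ) =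
          1 - (‖(α j : ℂ)‖ : ℂ) ^ 2 := by
        rw [← Complex.ofReal_mul, Real.mul_self_sqrt hpos.le]; push_cast; rfl
      have hne : (1 - (‖(α j : ℂ)‖ : ℂ) ^ 2) ≠ 0 := by
        exact_mod_cast hpos.ne'
      rw [← mul_assoc, hs, mul_comm (V _ _ _), ← mul_assoc, mul_inv_cancel₀ hne, one_mul]
    · have hlt := lt_of_le_of_ne hjl hjl'
      rw [if_neg hjl', partialBlaschke_eq_zero α (by simp [hlt]), zero_mul, mul_zero]

lemma orthonormal_tmVec : Orthonormal ℂ (tmVec (m := m) α) := by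
  classical
  rw [orthonormal_iff_ite]
  have key : ∀ (j l : Fin N) (i p : Fin m), j ≤ l →
      inner ℂ (tmVec α (j, i)) (tmVec α (l, p)) = if (j, i) = (l, p) then (1 : ℂ) else 0 := by
    intro j l i p hjl
    have h := inner_tmVec_mulOp α (v := fun _ => (1 : Mat m)) continuous_const
      (V := fun _ => 1) (fun _ _ => diffContOnCl_const) (fun _ => rfl) hjl i p
    rw [mulOp_one, one_apply_eq_self] at h
    rw [h]
    by_cases h1 : j = l <;> by_cases h2 : i = p <;> simp [h1, h2, Matrix.one_apply]
  rintro ⟨j, i⟩ ⟨l, p⟩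
  rcases le_total j l with h | h
  · exact key j l i p h
  · rw [← inner_conj_symm, key l j p i h]
    by_cases h1 : (j, i) = (l, p)
    · simp [h1]
    · rw [if_neg h1, if_neg (Ne.symm h1), map_zero]

lemma tmVec_mem_H2 (p : Fin N × Fin m) : tmVec α p ∈ H2 m := contFn_discFn_mem_H2 _ _

lemma blaschke_eq : blaschke α = discFn _ (isDisc_partialBlaschke α Finset.univ) := rfl

lemma mulOp_star_blaschke_tmVec (p : Fin N × Fin m) :
    mulOp (scalarSymbol m (star (discFn _ (isDisc_partialBlaschke α Finset.univ)) : C(Circle, ℂ)))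
      (tmVec α p) ∈ (H2 m)ᗮ := by
  rw [tmVec, mulOp_scalar_contFn, mem_H2_orthogonal_iff]
  intro n hn i
  lift n to ℕ using hn
  rw [mono, ← inner_conj_symm, inner_contFn_contFn]
  have h := integral_conj_tmFun_mul α p.1 (Finset.subset_univ _)
    (F := fun z => (1 : Mat m) p.2 i * z ^ n)
    (IsDisc.fun_mul diffContOnCl_const (differentiable_pow n).diffContOnCl)
  rw [partialBlaschke_eq_zero α (by simp), zero_mul, mul_zero] at h
  rw [← map_zero (starRingEnd ℂ), ← h]
  congr 1
  refine integral_congr_ae (Eventually.of_forall fun x => ?_)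
  simp only [ContinuousMap.mul_apply, ContinuousMap.star_apply, discFn_apply, zpowFn_apply,
    zpow_natCast, map_mul, Complex.star_def, Complex.conj_conj]
  ring

lemma tmVec_mem_modelSpace (p : Fin N × Fin m) :
    (⟨tmVec α p, tmVec_mem_H2 α p⟩ : H2 m) ∈ modelSpace m (blaschke α) := by
  rw [modelSpace, Submodule.mem_orthogonal]
  rintro g ⟨h, hh, hg⟩
  have hg' : (g : L2 m) = mulOp (scalarSymbol m (blaschke α)) h := hg.symm
  rw [Submodule.coe_inner, hg', blaschke_eq, inner_mulOp_scalar_left]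
  exact (Submodule.mem_orthogonal _ _).mp (mulOp_star_blaschke_tmVec α p) h hh

/-- The Takenaka–Malmquist vectors in the model space. -/
def tmModel (p : Fin N × Fin m) : modelSpace m (blaschke α) :=
  ⟨⟨tmVec α p, tmVec_mem_H2 α p⟩, tmVec_mem_modelSpace α p⟩

lemma orthonormal_tmModel : Orthonormal ℂ (tmModel (m := m) α) := by
  classical
  have h := orthonormal_tmVec (m := m) α
  rw [orthonormal_iff_ite] at h ⊢
  exact h

lemma mulOp_star_partialBlaschke_mem (f : H2 m)
    (h : ∀ p, inner ℂ (tmVec α p) (f : L2 m) = 0) (k : ℕ) (hk : k ≤ N) :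
    mulOp (scalarSymbol m (star (discFn _ (isDisc_partialBlaschke α
      (Finset.univ.filter fun l => (l : ℕ) < k))) : C(Circle, ℂ))) (f : L2 m) ∈ H2 m := by
  induction k with
  | zero =>
    have h1 : (star (discFn _ (isDisc_partialBlaschke α
        (Finset.univ.filter fun l : Fin N => (l : ℕ) < 0))) : C(Circle, ℂ)) = 1 := by
      ext t; simp [discFn_apply, partialBlaschke]
    rw [h1, mulOp_scalar_one]
    exact f.2
  | succ k ih =>
    let j : Fin N := ⟨k, hk⟩
    have hIio : (Finset.univ.filter fun l : Fin N => (l : ℕ) < k) = Finset.Iio j := by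
      ext l; simp [j, Fin.lt_def]
    have hsucc : (Finset.univ.filter fun l : Fin N => (l : ℕ) < k + 1) =
        insert j (Finset.Iio j) := by
      ext l
      simp only [Finset.mem_filter, Finset.mem_univ, true_and, Finset.mem_insert, Finset.mem_Iio,
        Fin.lt_def, Fin.ext_iff]
      change (l : ℕ) < k + 1 ↔ (l : ℕ) = k ∨ (l : ℕ) < k
      omega
    have hg := ih (by omega)
    rw [hIio] at hg
    have hstar : (star (discFn _ (isDisc_partialBlaschke α
        (Finset.univ.filter fun l : Fin N => (l : ℕ) < k + 1))) : C(Circle, ℂ)) =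
        star (discFn _ (isDisc_blaschkeFactor (α j))) *
          star (discFn _ (isDisc_partialBlaschke α (Finset.Iio j))) := by
      ext t
      simp only [ContinuousMap.star_apply, ContinuousMap.mul_apply, discFn_apply, hsucc,
        partialBlaschke]
      rw [Finset.prod_insert (by simp), star_mul']
    rw [hstar, mulOp_scalar_mul]
    refine mulOp_star_blaschkeFactor_mem_H2 (α j) hg fun i => ?_
    change inner ℂ _ (mulOp (scalarSymbol m _) (f : L2 m)) = 0
    rw [← inner_mulOp_scalar_left, mulOp_scalar_contFn]
    have h1 := h (j, i)
    have htm : discFn _ (isDisc_tmFun α j) = (Real.sqrt (1 - ‖(α j : ℂ)‖ ^ 2) : ℂ) •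
        (discFn _ (isDisc_partialBlaschke α (Finset.Iio j)) * discFn _ (isDisc_szego (α j))) := by
      ext t; rfl
    rw [tmVec, htm, contFn_smul, inner_smul_left, Complex.conj_ofReal] at h1
    refine (mul_eq_zero.mp h1).resolve_left ?_
    exact_mod_cast (Real.sqrt_pos.mpr (one_sub_norm_sq_pos (α j))).ne'

lemma eq_zero_of_inner_tmModel_eq_zero (f : modelSpace m (blaschke α))
    (hf : ∀ p, inner ℂ (tmModel α p) f = 0) : f = 0 := by
  have h : ∀ p, inner ℂ (tmVec α p) ((f : H2 m) : L2 m) = 0 := hf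
  have h1 := mulOp_star_partialBlaschke_mem α (f : H2 m) h N le_rfl
  have hfil : (Finset.univ.filter fun l : Fin N => (l : ℕ) < N) = Finset.univ := by
    ext l; simp
  rw [hfil] at h1
  have hmem : (f : H2 m) ∈ shiftedH2 m (blaschke α) := by
    refine ⟨_, h1, ?_⟩
    change mulOp (scalarSymbol m (discFn _ (isDisc_partialBlaschke α Finset.univ))) _ =
      ((f : H2 m) : L2 m)
    rw [← ContinuousLinearMap.comp_apply, ← mulOp_scalar_mul]
    have : discFn _ (isDisc_partialBlaschke α Finset.univ) *
        star (discFn _ (isDisc_partialBlaschke α Finset.univ)) = 1 := by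
      ext t
      rw [mul_comm]
      exact conj_partialBlaschke_mul α _ t
    rw [this, mulOp_scalar_one, one_apply_eq_self]
  have h0 := (Submodule.mem_orthogonal _ _).mp f.2 _ hmem
  exact Subtype.ext (inner_self_eq_zero.mp h0)

/-- A finite orthonormal family without nonzero orthogonal vectors is an orthonormal basis. -/
def orthonormalBasisOfComplete {E ι : Type*} [NormedAddCommGroup E] [InnerProductSpace ℂ E]
    [Fintype ι] {e : ι → E} (he : Orthonormal ℂ e)
    (h : ∀ f : E, (∀ p, inner ℂ (e p) f = 0) → f = 0) : OrthonormalBasis ι ℂ E :=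
  OrthonormalBasis.mkOfOrthogonalEqBot he ((Submodule.eq_bot_iff _).mpr fun f hf => h f fun p =>
    (Submodule.mem_orthogonal _ _).mp hf _ (Submodule.subset_span ⟨p, rfl⟩))

lemma orthonormalBasisOfComplete_apply {E ι : Type*} [NormedAddCommGroup E]
    [InnerProductSpace ℂ E] [Fintype ι] {e : ι → E} (he : Orthonormal ℂ e)
    (h : ∀ f : E, (∀ p, inner ℂ (e p) f = 0) → f = 0) (p : ι) :
    orthonormalBasisOfComplete he h p = e p := by
  rw [orthonormalBasisOfComplete, OrthonormalBasis.coe_of_orthogonal_eq_bot_mk]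

/-- The Takenaka–Malmquist basis of the model space. -/
def tmBasis (m : ℕ) : OrthonormalBasis (Fin N × Fin m) ℂ (modelSpace m (blaschke α)) :=
  orthonormalBasisOfComplete (orthonormal_tmModel α) (eq_zero_of_inner_tmModel_eq_zero α)

lemma tmBasis_apply (p : Fin N × Fin m) : tmBasis α m p = tmModel α p := by
  rw [tmBasis, orthonormalBasisOfComplete_apply]

end

section

variable {m N : ℕ} (α : Fin N → 𝔻)

/-! ### Determinants of analytic and coanalytic compressions -/

lemma inner_modelToeplitz {u : Circle → ℂ} (v : Circle → Mat m) (f g : modelSpace m u) :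
    inner ℂ f (modelToeplitz u v g) =
      inner ℂ ((f : H2 m) : L2 m) (mulOp v ((g : H2 m) : L2 m)) :=
  (Submodule.inner_orthogonalProjectionOnto_eq_of_mem_left f (toeplitz v (g : H2 m))).trans
    (inner_proj_right _ _)

/-- The matrix of `T_u(v)` in the Takenaka–Malmquist basis. -/
def tmMatrix (v : Circle → Mat m) : Matrix (Fin N × Fin m) (Fin N × Fin m) ℂ :=
  Matrix.of fun p q => inner ℂ (tmVec α p) (mulOp v (tmVec α q))

lemma det_modelToeplitz (v : Circle → Mat m) :
    LinearMap.det (modelToeplitz (blaschke α) v).toLinearMap = (tmMatrix α v).det := by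
  rw [← LinearMap.det_toMatrix (tmBasis α m).toBasis]
  congr 1
  ext p q
  rw [LinearMap.toMatrix_apply, OrthonormalBasis.coe_toBasis,
    OrthonormalBasis.coe_toBasis_repr_apply, OrthonormalBasis.repr_apply_apply, tmBasis_apply,
    tmBasis_apply]
  exact inner_modelToeplitz v _ _

lemma det_tmMatrix_of_isDisc {v : Circle → Mat m} (hv : Continuous v) {V : ℂ → Mat m}
    (hV : ∀ i j, IsDisc fun z => V z i j) (hVv : ∀ t : Circle, V t = v t) :
    (tmMatrix α v).det = ∏ j, (V (α j)).det := by
  have hbt : (tmMatrix α v).transpose.BlockTriangular Prod.fst := by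
    rintro ⟨l, p⟩ ⟨j, i⟩ hjl
    rw [Matrix.transpose_apply, tmMatrix, Matrix.of_apply,
      inner_tmVec_mulOp α hv hV hVv (le_of_lt hjl), if_neg (ne_of_lt hjl)]
  rw [← Matrix.det_transpose, hbt.det_fintype]
  refine Finset.prod_congr rfl fun j _ => ?_
  let e : Fin m ≃ {p : Fin N × Fin m // p.1 = j} :=
    { toFun := fun i => ⟨(j, i), rfl⟩
      invFun := fun p => p.1.2
      left_inv := fun i => rfl
      right_inv := by rintro ⟨⟨l, i⟩, rfl⟩; rfl }
  rw [← Matrix.det_submatrix_equiv_self e, ← Matrix.det_transpose]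
  congr 1
  ext i p
  have h := inner_tmVec_mulOp α hv hV hVv (le_refl j) i p
  rw [if_pos rfl] at h
  exact h

lemma tmMatrix_conjTranspose {v : Circle → Mat m} (hv : Continuous v) :
    tmMatrix α v = (tmMatrix α fun t => (v t).conjTranspose).conjTranspose := by
  ext p q
  rw [Matrix.conjTranspose_apply, tmMatrix, tmMatrix, Matrix.of_apply, Matrix.of_apply,
    ← inner_mulOp_left hv, Complex.star_def, inner_conj_symm]

lemma det_modelToeplitz_of_isPlusFactor {v : Circle → Mat m} (hv : IsPlusFactor v) :
    LinearMap.det (modelToeplitz (blaschke α) v).toLinearMap =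
      ∏ j, (discExt v (α j)).det := by
  rw [det_modelToeplitz, det_tmMatrix_of_isDisc α hv.isPlus.continuous
    (isDisc_discExt hv.memWK.isWiener) (discExt_circle hv.isPlus hv.memWK.isWiener)]

lemma det_modelToeplitz_of_isMinusFactor {v : Circle → Mat m} (hv : IsMinusFactor v) :
    LinearMap.det (modelToeplitz (blaschke α) v).toLinearMap =
      ∏ j, conj (discExt (conjSymbol v) (α j)).det := by
  rw [det_modelToeplitz, tmMatrix_conjTranspose α hv.isMinus.continuous,
    Matrix.det_conjTranspose, det_tmMatrix_of_isDisc α hv.isMinus.continuous.matrix_conjTranspose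
      (V := fun z => (discExt (conjSymbol v) z).transpose)
      (fun i j => isDisc_discExt (IsPlusFactor.memWK hv).isWiener j i) (fun t => by
        rw [discExt_circle (IsPlusFactor.isPlus hv) (IsPlusFactor.memWK hv).isWiener]
        rfl), Complex.star_def, map_prod]
  simp only [Matrix.det_transpose]

/-! ### Invariance of model spaces -/

lemma toeplitz_mem_modelSpace {v : Circle → Mat m} (hv : IsMinus v) {f : H2 m}
    (hf : f ∈ modelSpace m (blaschke α)) : toeplitz v f ∈ modelSpace m (blaschke α) := by
  rw [modelSpace, Submodule.mem_orthogonal'] at hf ⊢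
  rintro g ⟨h, hh, hg⟩
  have hg' : (g : L2 m) = mulOp (scalarSymbol m (blaschke α)) h := hg.symm
  have hc : Continuous fun t => (v t).conjTranspose := hv.continuous.matrix_conjTranspose
  rw [inner_toeplitz_left hv.continuous]
  refine hf _ ⟨mulOp (fun t => (v t).conjTranspose) h, IsPlus.mulOp_mem hv hh, ?_⟩
  have h1 : ((toeplitz (fun t => (v t).conjTranspose) g : H2 m) : L2 m) =
      mulOp (fun t => (v t).conjTranspose) (g : L2 m) :=
    coe_proj_of_mem (IsPlus.mulOp_mem hv g.2)
  change mulOp (scalarSymbol m (blaschke α)) (mulOp (fun t => (v t).conjTranspose) h) =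
    ((toeplitz (fun t => (v t).conjTranspose) g : H2 m) : L2 m)
  rw [h1, hg', blaschke_eq, mulOp_scalar_comm hc]

lemma modelToeplitz_factor {a vp vm : Circle → Mat m} (hvp : IsPlus vp) (hvm : IsMinus vm)
    {B : H2 m →L[ℂ] H2 m} (h : toeplitz a = toeplitz vp ∘L B ∘L toeplitz vm) :
    modelToeplitz (blaschke α) a = modelToeplitz (blaschke α) vp ∘L
      ((modelSpace m (blaschke α)).orthogonalProjectionOnto ∘L B ∘L
        (modelSpace m (blaschke α)).subtypeL) ∘L modelToeplitz (blaschke α) vm := by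
  set K := modelSpace m (blaschke α)
  have hm : ∀ f : K, ((modelToeplitz (blaschke α) vm f : K) : H2 m) = toeplitz vm (f : H2 m) :=
    fun f => Submodule.starProjection_eq_self_iff.mpr (toeplitz_mem_modelSpace α hvm f.2)
  have hp : ∀ q : H2 m, K.orthogonalProjectionOnto (toeplitz vp q) =
      K.orthogonalProjectionOnto (toeplitz vp (K.starProjection q)) := by
    intro q
    rw [← sub_eq_zero, ← map_sub, ← map_sub, Submodule.orthogonalProjectionOnto_eq_zero_iff,
      Submodule.mem_orthogonal]
    intro g hg
    have h0 := (Submodule.mem_orthogonal' _ _).mp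
      (Submodule.sub_starProjection_mem_orthogonal (K := K) q) _
      (toeplitz_mem_modelSpace α hvp.conjTranspose hg)
    rw [← inner_conj_symm, inner_toeplitz_left hvp.continuous, h0, map_zero]
  ext1 f
  have h1 : modelToeplitz (blaschke α) a f = K.orthogonalProjectionOnto (toeplitz a (f : H2 m)) :=
    rfl
  rw [h1, h, ContinuousLinearMap.comp_apply, ContinuousLinearMap.comp_apply, hp, ← hm]
  rfl

end

end ModelBO

end

theorem theorem1p1 (m : ℕ) (a wm wp vp vm : Circle → ModelBO.Mat m)
    (ha : ModelBO.MemWK a)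
    (hwm : ModelBO.IsMinusFactor wm) (hwp : ModelBO.IsPlusFactor wp)
    (hvp : ModelBO.IsPlusFactor vp) (hvm : ModelBO.IsMinusFactor vm)
    (haw : ∀ t, a t = wm t * wp t) (hav : ∀ t, a t = vp t * vm t)
    (b c : Circle → ModelBO.Mat m)
    (hb : ∀ t, b t = vm t * (wp t)⁻¹) (hc : ∀ t, c t = (wm t)⁻¹ * vp t)
    (N : ℕ) (α : Fin N → Complex.UnitDisc) (u : Circle → ℂ) (hu : u = ModelBO.blaschke α) :
    FiniteDimensional ℂ (ModelBO.modelSpace m u) ∧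
    ∃ (g : Fin N → ℂ) (dQ d : ℂ),
      (∀ j, ModelBO.IsGeometricMean (a ∘ ModelBO.moebiusCircle (-α j)) (g j)) ∧
      ModelBO.HasFredholmDet
        (1 - ModelBO.Qu m u ∘L ModelBO.hankel b ∘L ModelBO.hankel (ModelBO.tilde c) ∘L
          ModelBO.Qu m u) dQ ∧
      ModelBO.HasFredholmDet
        (1 - ModelBO.hankel b ∘L ModelBO.hankel (ModelBO.tilde c)) d ∧
      d ≠ 0 ∧
      LinearMap.det (ModelBO.modelToeplitz u a).toLinearMap = (∏ j, g j) * (dQ / d) := by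
  subst hu
  have hfin : FiniteDimensional ℂ (ModelBO.modelSpace m (ModelBO.blaschke α)) :=
    (ModelBO.tmBasis α m).toBasis.finiteDimensional_of_finite
  obtain ⟨htr, B, hAB, hBA, hT⟩ :=
    ModelBO.exists_inverse_one_sub_hankel hwm hwp hvp hvm haw hav hb hc
  obtain ⟨dQ, d, hdQ, hd, hd0, hdet⟩ := ModelBO.exists_hasFredholmDet_jacobi
    (ModelBO.modelSpace m (ModelBO.blaschke α)) htr hAB hBA
  refine ⟨hfin, fun j => (ModelBO.discExt vp (α j)).det *
    (starRingEnd ℂ) (ModelBO.discExt (ModelBO.conjSymbol vm) (α j)).det, dQ, d,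
    fun j => ModelBO.isGeometricMean_comp_moebius hvp hvm hav (α j), hdQ, hd, hd0, ?_⟩
  rw [ModelBO.modelToeplitz_factor α hvp.isPlus hvm.isMinus hT, ← hdet,
    Finset.prod_mul_distrib, ← ModelBO.det_modelToeplitz_of_isPlusFactor α hvp,
    ← ModelBO.det_modelToeplitz_of_isMinusFactor α hvm]
  rw [ContinuousLinearMap.toLinearMap_comp, ContinuousLinearMap.toLinearMap_comp,
    LinearMap.det_comp, LinearMap.det_comp]
  ring
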